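/- **Setting.** A finite random variable is a function $X:\Omega\to\mathbb R$ on a finite set $\Omega$ with a probability mass function $\Pr$ on $\Omega$. For $p\in[0,1]$ its quantile of order $p$ is $Q(p)=\sup\{x\in\mathbb R:\Pr[X\ge x]\ge p\}$. A q-variable $(\mathcal H,U,M)$, i.e. a finite-dimensional Hilbert space with an initial unit vector $|0\rangle$, a unitary $U$ on $\mathcal H$ and a projective measurement $M=\{M_x\}_{x\in E}$ with $E\subset\mathbb R$ finite, generates $X$ if $\mathcal H$ has an orthonormal basis $\{|\omega\rangle\}_{\omega\in\Omega}$ such that $U|0\rangle=\sum_\omega\sqrt{\Pr(\omega)}\,|\omega\rangle$, $X(\Omega)\subseteq E$, and $M_x=\sum_{\omega:X(\omega)=x}|\omega\rangle\langle\omega|$ for $x\in E$. We are also given, for all $a<b$ in $\mathbb R\cup\{\pm\infty\}$, unitaries $C_{a,b}$ and $R_{a,b}$ on $\mathcal H\otimes\mathbb C^2$ such that: $C_{a,b}|\omega\rangle|0\rangle$ equals $|\omega\rangle|1\rangle$ if $a<X(\omega)\le b$ and $|\omega\rangle|0\rangle$ otherwise; and, whenever $b\neq 0$ and $|X(\omega)/b|\le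 1$ for all $\omega$ with $a<X(\omega)\le b$, $R_{a,b}|\omega\rangle|0\rangle$ equals $|\omega\rangle\bigl(\sqrt{1-|X(\omega)/b|}\,|0\rangle+\sqrt{|X(\omega)/b|}\,|1\rangle\bigr)$ if $a<X(\omega)\le b$ and $|\omega\rangle|0\rangle$ otherwise. A quantum experiment is one application of $U$, $C_{a,b}$, $R_{a,b}$, of an inverse or of a controlled version of one of these, or one measurement according to $M$. **Algorithm** $\mathrm{Quantile}(X,p,\delta)$, depending on a constant $c'>0$. Repeat the following $m=\lceil 6\log_2(1/\delta)\rceil$ times: set $y=-\infty$; repeatedly replace $y$ by a sample of $X$ conditioned on being larger than $y$; interrupt this when $\lceil c'/\sqrt p\,\rceil$ quantum experiments have been performed, and record the current $y$. Output the median $\widetilde Q$ of the $m$ recorded values (the upper one of the two middle values if $m$ is even). A conditional sample is produced by sequential amplitude amplification with $V=C_{y,+\infty}(U\otimes I)$: for $\ell=1,2,\dots$ and $\lambda=1.1$, pick $n$ uniformly at random among the integers with $\lfloor\lambda^{\ell-1}\rfloor\le n\le\lceil\lambda^{\ell}\rceil-1$, prepare the state $\bigl(V(2|0\rangle\langle 0|-I)V^\dagger(I-2\Pi)\bigr)^nV|0\rangle$,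 where $|0\rangle$ stands for the initial state $|0\rangle|0\rangle$ of $\mathcal H\otimes\mathbb C^2$ and $\Pi=I\otimes|1\rangle\langle1|$, and measure $\{I-\Pi,\Pi\}$; at the first outcome $\Pi$, measure $\mathcal H$ according to $M$ and return the result. **Theorem (Quantile estimation).** There are universal constants $c'>0$, $0<c<1$ and $K>0$ such that, for every finite random variable $X$ generated by a q-variable with oracles as above and for all $p,\delta\in(0,1)$, the output $\widetilde Q$ of $\mathrm{Quantile}(X,p,\delta)$ satisfies $$Q(p)\le\widetilde Q\le Q(cp)$$ with probability at least $1-\delta$, and the algorithm performs (with certainty) at most $$K\cdot\frac{\max\{1,\log_2(1/\delta)\}}{\sqrt p}$$ quantum experiments; in particular it performs $O\bigl(\log(1/\delta)/\sqrt p\bigr)$ quantum experiments when $\delta\le 1/2$. -/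

import Mathlib

open scoped TensorProduct

noncomputable section

/-! ### Finite random variables and quantiles -/

/-- A finite random variable: a probability mass function on a finite sample set `Ω`,
and a real-valued function on `Ω`. -/
structure FiniteRV (Ω : Type*) [Fintype Ω] where
  pmf : Ω → ℝ
  pmf_nonneg : ∀ ω, 0 ≤ pmf ω
  pmf_sum : ∑ ω, pmf ω = 1
  val : Ω → ℝ

open Classical in
/-- `Pr[X ≥ x]`. -/
def FiniteRV.probGE {Ω : Type*} [Fintype Ω] (X : FiniteRV Ω) (x : ℝ) : ℝ :=
  ∑ ω with x ≤ X.val ω, X.pmf ω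

/-- The quantile `Q(p) = sup {x ∈ ℝ : Pr[X ≥ x] ≥ p}`, as an extended real. -/
def FiniteRV.quantile {Ω : Type*} [Fintype Ω] (X : FiniteRV Ω) (p : ℝ) : EReal :=
  sSup ((fun x : ℝ => (x : EReal)) '' {x : ℝ | p ≤ X.probGE x})

/-! ### q-variables, q-random variables and oracles -/

/-- The one-qubit space `ℂ²`. -/
abbrev Qubit : Type := EuclideanSpace ℂ (Fin 2)

/-- The computational basis vectors `|0⟩` and `|1⟩` of `ℂ²`. -/
abbrev ket (i : Fin 2) : Qubit := EuclideanSpace.single i 1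

/-- A q-variable on the finite-dimensional Hilbert space `H`, with its distinguished initial
state `|0⟩`: a unitary `U` and a projective measurement `M` indexed by a finite set `E` of reals. -/
structure QVariable (H : Type*) [NormedAddCommGroup H] [InnerProductSpace ℂ H]
    [FiniteDimensional ℂ H] where
  ket0 : H
  norm_ket0 : ‖ket0‖ = 1
  U : H ≃ₗᵢ[ℂ] H
  E : Finset ℝ
  M : ℝ → H →ₗ[ℂ] H
  M_proj : ∀ x ∈ E, (M x).IsSymmetricProjection
  M_orthogonal : ∀ x ∈ E, ∀ y ∈ E, x ≠ y → M x ∘ₗ M y = 0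
  M_sum : ∑ x ∈ E, M x = LinearMap.id

/-- A q-variable together with two families of unitaries on `H ⊗ ℂ²`, the candidates for the
comparison oracles `C_{a,b}` and the rotation oracles `R_{a,b}`. This is all that an algorithm
has access to; the sample space is not part of it. -/
structure QDevice (H : Type*) [NormedAddCommGroup H] [InnerProductSpace ℂ H]
    [FiniteDimensional ℂ H] extends QVariable H where
  C : EReal → EReal → (H ⊗[ℂ] Qubit) ≃ₗᵢ[ℂ] (H ⊗[ℂ] Qubit)
  R : EReal → EReal → (H ⊗[ℂ] Qubit) ≃ₗᵢ[ℂ] (H ⊗[ℂ] Qubit)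

section Generates

variable {Ω : Type*} [Fintype Ω]
  {H : Type*} [NormedAddCommGroup H] [InnerProductSpace ℂ H] [FiniteDimensional ℂ H]

open Classical in
/-- The q-variable `V` generates `X`, where `b ω` is the basis vector `|ω⟩`. -/
structure QVariable.Generates (V : QVariable H) (b : OrthonormalBasis Ω ℂ H)
    (X : FiniteRV Ω) : Prop where
  U_ket0 : V.U V.ket0 = ∑ ω, ((Real.sqrt (X.pmf ω) : ℝ) : ℂ) • b ω
  val_mem : ∀ ω, X.val ω ∈ V.E
  M_eq : ∀ x ∈ V.E, ∀ v : H, V.M x v = ∑ ω with X.val ω = x, inner ℂ (b ω) v • b ω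

open Classical in
/-- The family `C` is a comparison oracle for `X`. -/
def IsComparisonOracle (b : OrthonormalBasis Ω ℂ H) (X : FiniteRV Ω)
    (C : EReal → EReal → (H ⊗[ℂ] Qubit) ≃ₗᵢ[ℂ] (H ⊗[ℂ] Qubit)) : Prop :=
  ∀ a c : EReal, a < c → ∀ ω,
    C a c (b ω ⊗ₜ[ℂ] ket 0) =
      if a < (X.val ω : EReal) ∧ (X.val ω : EReal) ≤ c then b ω ⊗ₜ[ℂ] ket 1
      else b ω ⊗ₜ[ℂ] ket 0

open Classical in
/-- The family `R` is a rotation oracle for `X`. The requirement on `R a c` is imposed whenever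
the prescribed vectors make sense, i.e. `c ≠ 0` and `|X(ω) / c| ≤ 1` for all `ω` with
`a < X(ω) ≤ c`. For `c = +∞` the ratio `X(ω) / c` is `0`. -/
def IsRotationOracle (b : OrthonormalBasis Ω ℂ H) (X : FiniteRV Ω)
    (R : EReal → EReal → (H ⊗[ℂ] Qubit) ≃ₗᵢ[ℂ] (H ⊗[ℂ] Qubit)) : Prop :=
  ∀ a c : EReal, a < c → c ≠ 0 →
    (∀ ω, a < (X.val ω : EReal) → (X.val ω : EReal) ≤ c → |X.val ω / c.toReal| ≤ 1) →
    ∀ ω, R a c (b ω ⊗ₜ[ℂ] ket 0) =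
      if a < (X.val ω : EReal) ∧ (X.val ω : EReal) ≤ c then
        b ω ⊗ₜ[ℂ] (((Real.sqrt (1 - |X.val ω / c.toReal|) : ℝ) : ℂ) • ket 0
          + ((Real.sqrt |X.val ω / c.toReal| : ℝ) : ℂ) • ket 1)
      else b ω ⊗ₜ[ℂ] ket 0

end Generates

/-! ### Algorithms and quantum experiments

An algorithm is a finite-depth tree of instructions acting on a quantum register
`(H ⊗ ℂ²) ⊗ ℂ²`: the space `H`, the flag qubit on which the oracles act, and a control qubit.
The tree does not refer to `H` or to the random variable. -/

/-- The unitaries to which an algorithm has access. -/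
inductive Oracle : Type
  /-- the unitary `U` -/
  | prep : Oracle
  /-- the comparison oracle `C_{a,c}` -/
  | comp (a c : EReal) : Oracle
  /-- the rotation oracle `R_{a,c}` -/
  | rot (a c : EReal) : Oracle

/-- Unitary instructions. -/
inductive Gate : Type
  /-- an oracle or its inverse, possibly controlled by the control qubit -/
  | oracle (o : Oracle) (inverse controlled : Bool) : Gate
  /-- a one-qubit unitary on the flag qubit -/
  | flag (W : Qubit ≃ₗᵢ[ℂ] Qubit) : Gate
  /-- a one-qubit unitary on the control qubit -/
  | control (W : Qubit ≃ₗᵢ[ℂ] Qubit) : Gate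
  /-- the reflection `2 |0⟩|0⟩⟨0|⟨0| - I` on `H ⊗ ℂ²` -/
  | reflectZero : Gate

/-- The number of quantum experiments of a gate: the oracles, their inverses and their controlled
versions count one each; the input-independent gates are free. -/
def Gate.cost : Gate → ℕ
  | .oracle _ _ _ => 1
  | .flag _ => 0
  | .control _ => 0
  | .reflectZero => 0

/-- Quantum algorithms with classical randomness, classical control, and outputs in `α`. -/
inductive QProg (α : Type) : Type
  /-- stop and output a value -/
  | ret (a : α) : QProg α
  /-- discard the register and prepare `|0⟩|0⟩|0⟩` -/
  | reset (k : QProg α) : QProg α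
  /-- apply a gate -/
  | gate (g : Gate) (k : QProg α) : QProg α
  /-- measure `H` according to `M` (one quantum experiment) -/
  | measureM (k : ℝ → QProg α) : QProg α
  /-- measure the flag qubit in the computational basis -/
  | measureFlag (k : Fin 2 → QProg α) : QProg α
  /-- draw an integer uniformly at random from a finite nonempty set -/
  | unif (s : Finset ℕ) (hs : s.Nonempty) (k : ℕ → QProg α) : QProg α

namespace QProg

/-- Sequential composition. -/
def bind {α β : Type} : QProg α → (α → QProg β) → QProg β
  | ret a, f => f a
  | reset k, f => reset (bind k f)
  | gate g k, f => gate g (bind k f)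
  | measureM k, f => measureM fun x => bind (k x) f
  | measureFlag k, f => measureFlag fun i => bind (k i) f
  | unif s hs k, f => unif s hs fun n => bind (k n) f

/-- Apply a list of gates, the head of the list first. -/
def gates {α : Type} : List Gate → QProg α → QProg α
  | [], k => k
  | g :: l, k => gate g (gates l k)

/-- Interrupt a program when it attempts more than `r` quantum experiments. The new output is
`none` if the program was interrupted, and otherwise its output together with the number of
experiments that are left. -/
def interrupt {α : Type} : QProg α → ℕ → QProg (Option (α × ℕ))
  | ret a, r => ret (some (a, r))
  | reset k, r => reset (interrupt k r)
  | gate g k, r => if g.cost ≤ r then gate g (interrupt k (r - g.cost)) else ret none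
  | measureM k, r => if 1 ≤ r then measureM fun x => interrupt (k x) (r - 1) else ret none
  | measureFlag k, r => measureFlag fun i => interrupt (k i) r
  | unif s hs k, r => unif s hs fun n => interrupt (k n) r

/-- Run a program `m` times and collect the outputs. -/
def replicate {α : Type} (m : ℕ) (P : QProg α) : QProg (List α) :=
  match m with
  | 0 => ret []
  | m + 1 => bind P fun a => bind (replicate m P) fun l => ret (a :: l)

end QProg

/-! ### Execution of an algorithm -/

section Execution

variable {H : Type*} [NormedAddCommGroup H] [InnerProductSpace ℂ H] [FiniteDimensional ℂ H]

/-- The quantum register. -/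
abbrev Register (H : Type*) [NormedAddCommGroup H] [InnerProductSpace ℂ H] : Type _ :=
  (H ⊗[ℂ] Qubit) ⊗[ℂ] Qubit

/-- The projection `|i⟩⟨i|` on `ℂ²`. -/
def qubitProj (i : Fin 2) : Qubit →ₗ[ℂ] Qubit :=
  (InnerProductSpace.rankOne ℂ (ket i) (ket i)).toLinearMap

/-- The state `|0⟩|0⟩` of `H ⊗ ℂ²`. -/
def QDevice.zeroState (D : QDevice H) : H ⊗[ℂ] Qubit := D.ket0 ⊗ₜ[ℂ] ket 0

/-- The unitary on `H ⊗ ℂ²` of an oracle. -/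
def QDevice.oracleMap (D : QDevice H) : Oracle → (H ⊗[ℂ] Qubit) ≃ₗᵢ[ℂ] (H ⊗[ℂ] Qubit)
  | .prep => TensorProduct.congrIsometry D.U (LinearIsometryEquiv.refl ℂ Qubit)
  | .comp a c => D.C a c
  | .rot a c => D.R a c

/-- The action of a gate on the register. -/
def QDevice.gateMap (D : QDevice H) : Gate → Register H →ₗ[ℂ] Register H
  | .oracle o inverse controlled =>
      let W : (H ⊗[ℂ] Qubit) ≃ₗᵢ[ℂ] (H ⊗[ℂ] Qubit) :=
        if inverse then (D.oracleMap o).symm else D.oracleMap o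
      if controlled then
        TensorProduct.map LinearMap.id (qubitProj 0)
          + TensorProduct.map W.toLinearEquiv.toLinearMap (qubitProj 1)
      else TensorProduct.map W.toLinearEquiv.toLinearMap LinearMap.id
  | .flag W =>
      TensorProduct.map (TensorProduct.map LinearMap.id W.toLinearEquiv.toLinearMap) LinearMap.id
  | .control W => TensorProduct.map LinearMap.id W.toLinearEquiv.toLinearMap
  | .reflectZero =>
      TensorProduct.map
        ((2 : ℂ) • (InnerProductSpace.rankOne ℂ D.zeroState D.zeroState).toLinearMap
          - LinearMap.id) LinearMap.id

open Classical in
/-- `D.prob P ψ t S` is the weight of the event `S` on pairs (output of `P`, number of quantum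
experiments performed) when `P` is run on the state `ψ` after `t` experiments have already been
performed. By the Born rule, the state obtained along a sequence of outcomes is kept unnormalized:
its squared norm is the probability of that sequence. -/
def QDevice.prob (D : QDevice H) {α : Type} :
    QProg α → Register H → ℕ → (α → ℕ → Prop) → ℝ
  | .ret a, ψ, t, S => if S a t then ‖ψ‖ ^ 2 else 0
  | .reset k, ψ, t, S => D.prob k (((‖ψ‖ : ℝ) : ℂ) • (D.zeroState ⊗ₜ[ℂ] ket 0)) t S
  | .gate g k, ψ, t, S => D.prob k (D.gateMap g ψ) (t + g.cost) S
  | .measureM k, ψ, t, S =>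
      ∑ x ∈ D.E, D.prob (k x)
        (TensorProduct.map (TensorProduct.map (D.M x) LinearMap.id) LinearMap.id ψ) (t + 1) S
  | .measureFlag k, ψ, t, S =>
      ∑ i : Fin 2, D.prob (k i)
        (TensorProduct.map (TensorProduct.map LinearMap.id (qubitProj i)) LinearMap.id ψ) t S
  | .unif s _ k, ψ, t, S => (∑ n ∈ s, D.prob (k n) ψ t S) / (s.card : ℝ)

/-- The probability that running `P`, from the register `|0⟩|0⟩|0⟩`, yields an output and a
number of quantum experiments satisfying `S`. -/
def QDevice.Pr (D : QDevice H) {α : Type} (P : QProg α) (S : α → ℕ → Prop) : ℝ :=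
  D.prob P (D.zeroState ⊗ₜ[ℂ] ket 0) 0 S

end Execution

/-! ### The quantile estimation algorithm -/

/-- The flag reflection `I - 2 |1⟩⟨1|`. -/
def flagReflection : Qubit ≃ₗᵢ[ℂ] Qubit :=
  LinearIsometryEquiv.piLpCongrRight 2
    ![LinearIsometryEquiv.refl ℂ ℂ, LinearIsometryEquiv.neg ℂ]

/-- The gates of `V = C_{y,+∞} (U ⊗ I)`. -/
def samplerGates (y : EReal) : List Gate :=
  [.oracle .prep false false, .oracle (.comp y ⊤) false false]

/-- The gates of the inverse of `V = C_{y,+∞} (U ⊗ I)`. -/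
def samplerInvGates (y : EReal) : List Gate :=
  [.oracle (.comp y ⊤) true false, .oracle .prep true false]

/-- Amplitude amplification with `n` iterations, for `V = C_{y,+∞} (U ⊗ I)` and
`Π = I ⊗ |1⟩⟨1|`: the gates of `(V (2|0⟩⟨0| - I) V† (I - 2Π))ⁿ V`. -/
def amplificationGates (y : EReal) (n : ℕ) : List Gate :=
  samplerGates y ++ (List.replicate n
    ([Gate.flag flagReflection] ++ samplerInvGates y ++ [Gate.reflectZero]
      ++ samplerGates y)).flatten

/-- The integers between `λ ^ (ℓ - 1)` and `λ ^ ℓ - 1` for `λ = 1.1`, where the two ends are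
rounded outwards: `⌊λ ^ (ℓ - 1)⌋ ≤ n ≤ ⌈λ ^ ℓ⌉ - 1`. -/
def iterationRange (l : ℕ) : Finset ℕ :=
  Finset.Ico ⌊(1.1 : ℝ) ^ (l - 1)⌋₊ ⌈(1.1 : ℝ) ^ l⌉₊

theorem iterationRange_nonempty (l : ℕ) (hl : 1 ≤ l) : (iterationRange l).Nonempty := by
  rw [iterationRange, Finset.nonempty_Ico]
  have h1 : (1.1 : ℝ) ^ (l - 1) < (1.1 : ℝ) ^ l :=
    pow_lt_pow_right₀ (by norm_num) (by omega)
  have h2 : ((⌊(1.1 : ℝ) ^ (l - 1)⌋₊ : ℕ) : ℝ) ≤ (1.1 : ℝ) ^ (l - 1) :=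
    Nat.floor_le (by positivity)
  have h3 : (1.1 : ℝ) ^ l ≤ ((⌈(1.1 : ℝ) ^ l⌉₊ : ℕ) : ℝ) := Nat.le_ceil _
  exact_mod_cast lt_of_le_of_lt h2 (lt_of_lt_of_le h1 h3)

/-- One iteration of sequential amplitude amplification, at stage `l + 1`: pick the number of
amplification iterations at random, amplify, and measure the flag. If the outcome is `1`, measure
according to `M` and output the sample; otherwise output `none`. -/
def samplingRound (l : ℕ) (y : EReal) : QProg (Option ℝ) :=
  .unif (iterationRange (l + 1)) (iterationRange_nonempty (l + 1) (by omega)) fun n =>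
    .reset <| .gates (amplificationGates y n) <| .measureFlag fun i =>
      if i = 1 then .measureM fun x => .ret (some x) else .ret none

/-- Replace the current value `y` by a sample of `X` conditioned on being larger than `y`,
repeatedly, until `r` more quantum experiments have been performed; then output the current value.
Each sample is obtained by sequential amplitude amplification, i.e. rounds at stages
`1, 2, 3, …` until one succeeds; the argument `l` is the number of rounds that have failed since
the last sample. The first argument bounds the number of rounds: as every round performs at least
one experiment, it has no effect when it is at least `r`. -/
def climb : ℕ → ℕ → ℕ → EReal → QProg EReal
  | 0, _, _, y => .ret y
  | fuel + 1, r, l, y =>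
    ((samplingRound l y).interrupt r).bind fun
      | none => .ret y
      | some (none, r') => climb fuel r' (l + 1) y
      | some (some x, r') => climb fuel r' 0 (x : EReal)

/-- The median of a list: after sorting, its middle entry, or the upper one of the two middle
entries when the length is even. -/
def listMedian (l : List EReal) : EReal :=
  (l.mergeSort (fun a b => decide (a ≤ b))).getD (l.length / 2) ⊥

/-- The algorithm `Quantile(X, p, δ)`, with budget constant `c'`: repeat `⌈6 log₂(1/δ)⌉` times the
climb from `-∞` interrupted after `⌈c' / √p⌉` quantum experiments, and output the median. -/
def quantileAlgorithm (c' p δ : ℝ) : QProg EReal :=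
  (QProg.replicate ⌈6 * Real.logb 2 (1 / δ)⌉₊
    (climb ⌈c' / Real.sqrt p⌉₊ ⌈c' / Real.sqrt p⌉₊ 0 ⊥)).bind fun l => .ret (listMedian l)

end

/-! ### Expected values of the output of an algorithm -/

section Weight

variable {H : Type*} [NormedAddCommGroup H] [InnerProductSpace ℂ H] [FiniteDimensional ℂ H]

/-! Every sampling round begins with a reset, so a climb is a classical Markov chain on (remaining
budget, stage, current value). Its transition weights come from amplitude amplification, which acts
as a rotation in the plane spanned by the flagged and unflagged parts of `V|0⟩`. Write `s = Pr[X >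
y]`.

A single climb errs on either side with probability at most `1/64`. It rarely overshoots: `n`
iterations multiply the amplitude above a level `z` by at most `2n + 1`, so a round costing at least
`4n + 2` passes `z` with probability at most `Pr[X > z] (4n + 2)² / 4`. Superadditivity of the
square gives `Pr[X > z] r² / 4` for a whole budget `r` (`expect_climb_gt_le`), which is small when
`r` is of order `1/√p` and `z = Q(cp)` with `c` small.

It rarely stops short: sequential amplification produces one conditional sample at expected cost at
most `A/√s` (`exists_stage_cost`). The function `2A/√p - A/√s` solves the integral recursion "cost
of one sample plus average over the new value", so it bounds the expected cost of reaching `s < p`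
(`sum_remaining_le`), and Markov's inequality bounds the failure probability
(`mul_expect_climb_low_le`).

The median is wrong only if half of the independent climbs err on the same side. An exponential
moment bounds each side by `(1/4)^m` (`one_le_prod_of_length_le_two_mul_countP`,
`expect_replicate_climb_le`). The bound on the number of experiments holds on every branch, by the
interruption (`always_quantileAlgorithm`). -/

theorem TensorProduct.norm_smul_eq {A B : Type*} [NormedAddCommGroup A] [InnerProductSpace ℂ A]
    [NormedAddCommGroup B] [InnerProductSpace ℂ B] (c : ℂ) (x : A ⊗[ℂ] B) :
    ‖c • x‖ = ‖c‖ * ‖x‖ := norm_smul c x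

/-- The initial state of the register. -/
noncomputable def QDevice.init (D : QDevice H) : Register H := D.zeroState ⊗ₜ[ℂ] ket 0

/-- The expected value of `F` at the output of a program run on an unnormalized state. -/
noncomputable def QDevice.expect (D : QDevice H) {α : Type} :
    QProg α → Register H → (α → ℝ) → ℝ
  | .ret a, ψ, F => ‖ψ‖ ^ 2 * F a
  | .reset k, ψ, F => D.expect k (((‖ψ‖ : ℝ) : ℂ) • D.init) F
  | .gate g k, ψ, F => D.expect k (D.gateMap g ψ) F
  | .measureM k, ψ, F =>
      ∑ x ∈ D.E, D.expect (k x)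
        (TensorProduct.map (TensorProduct.map (D.M x) LinearMap.id) LinearMap.id ψ) F
  | .measureFlag k, ψ, F =>
      ∑ i : Fin 2, D.expect (k i)
        (TensorProduct.map (TensorProduct.map LinearMap.id (qubitProj i)) LinearMap.id ψ) F
  | .unif s _ k, ψ, F => (∑ n ∈ s, D.expect (k n) ψ F) / (s.card : ℝ)

namespace QDevice

variable (D : QDevice H) {α β : Type}

@[simp] theorem norm_init : ‖D.init‖ = 1 := by
  simp [init, zeroState, D.norm_ket0]

/-- Events that ignore the experiment counter can be handled by `expect`, which is linear in the
test function. -/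
theorem prob_eq_expect (P : QProg α) (ψ : Register H) (t : ℕ) (S : α → Prop)
    [DecidablePred S] :
    D.prob P ψ t (fun a _ => S a) = D.expect P ψ (fun a => if S a then 1 else 0) := by
  induction P generalizing ψ t with
  | ret a => simp [prob, expect]
  | reset k ih => exact ih _ _
  | gate g k ih => exact ih _ _
  | measureM k ih => exact Finset.sum_congr rfl fun x _ => ih x _ _
  | measureFlag k ih => exact Finset.sum_congr rfl fun x _ => ih x _ _
  | unif s hs k ih =>
    exact congrArg (· / (s.card : ℝ)) (Finset.sum_congr rfl fun x _ => ih x _ _)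

theorem expect_smul (P : QProg α) (c : ℂ) (ψ : Register H) (F : α → ℝ) :
    D.expect P (c • ψ) F = ‖c‖ ^ 2 * D.expect P ψ F := by
  induction P generalizing c ψ with
  | ret a => simp only [expect, TensorProduct.norm_smul_eq c ψ]; ring
  | reset k ih =>
    simp only [expect, ih, TensorProduct.norm_smul_eq c ψ, Complex.norm_real, Real.norm_eq_abs,
      sq_abs]
    ring
  | gate g k ih => simp only [expect, map_smul, ih]
  | measureM k ih => simp only [expect, map_smul, ih, Finset.mul_sum]
  | measureFlag k ih => simp only [expect, map_smul, ih, Finset.mul_sum]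
  | unif s hs k ih => simp only [expect, ih, ← Finset.mul_sum, mul_div_assoc]

theorem expect_reset (P : QProg α) (ψ : Register H) (F : α → ℝ) :
    D.expect (.reset P) ψ F = ‖ψ‖ ^ 2 * D.expect P D.init F := by
  simp [expect, expect_smul]

theorem expect_mono (P : QProg α) (ψ : Register H) {F G : α → ℝ} (h : ∀ a, F a ≤ G a) :
    D.expect P ψ F ≤ D.expect P ψ G := by
  induction P generalizing ψ with
  | ret a => exact mul_le_mul_of_nonneg_left (h a) (by positivity)
  | reset k ih => exact ih _
  | gate g k ih => exact ih _
  | measureM k ih => exact Finset.sum_le_sum fun x _ => ih x _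
  | measureFlag k ih => exact Finset.sum_le_sum fun x _ => ih x _
  | unif s hs k ih =>
    exact div_le_div_of_nonneg_right (Finset.sum_le_sum fun x _ => ih x _) (by positivity)

theorem expect_linear (P : QProg α) (ψ : Register H) (F G : α → ℝ) (x y : ℝ) :
    D.expect P ψ (fun a => x * F a + y * G a) = x * D.expect P ψ F + y * D.expect P ψ G := by
  induction P generalizing ψ with
  | ret a => simp only [expect]; ring
  | reset k ih => exact ih _
  | gate g k ih => exact ih _
  | measureM k ih => simp only [expect, ih, Finset.sum_add_distrib, Finset.mul_sum]
  | measureFlag k ih => simp only [expect, ih, Finset.sum_add_distrib, Finset.mul_sum]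
  | unif s hs k ih =>
    simp only [expect, ih, Finset.sum_add_distrib, ← Finset.mul_sum]; ring

/-- The expected value of `F` depends on the initial state only through its norm. -/
def StateFree (P : QProg α) (F : α → ℝ) : Prop :=
  ∀ ψ, D.expect P ψ F = ‖ψ‖ ^ 2 * D.expect P D.init F

theorem stateFree_ret (a : α) (F : α → ℝ) : D.StateFree (.ret a) F := by
  intro ψ; simp [expect]

theorem stateFree_reset (P : QProg α) (F : α → ℝ) : D.StateFree (.reset P) F := by
  intro ψ; rw [expect_reset, D.expect_reset P D.init]; simp

theorem stateFree_unif (s : Finset ℕ) (hs : s.Nonempty) (k : ℕ → QProg α) (F : α → ℝ)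
    (h : ∀ n, D.StateFree (k n) F) : D.StateFree (.unif s hs k) F := by
  intro ψ
  simp only [expect]
  rw [Finset.sum_congr rfl fun n _ => h n ψ, ← Finset.mul_sum, mul_div_assoc]

/-- State-free continuations see the state left by `P` only through its squared norm, which is the
branch probability; composition thus becomes classical conditioning on the output. -/
theorem expect_bind (P : QProg α) (f : α → QProg β) (F : β → ℝ)
    (h : ∀ a, D.StateFree (f a) F) (ψ : Register H) :
    D.expect (P.bind f) ψ F = D.expect P ψ fun a => D.expect (f a) D.init F := by
  induction P generalizing ψ with
  | ret a => exact h a ψ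
  | reset k ih => exact ih _
  | gate g k ih => exact ih _
  | measureM k ih => exact Finset.sum_congr rfl fun x _ => ih x _
  | measureFlag k ih => exact Finset.sum_congr rfl fun x _ => ih x _
  | unif s hs k ih =>
    exact congrArg (· / (s.card : ℝ)) (Finset.sum_congr rfl fun x _ => ih x _)

theorem stateFree_bind (P : QProg α) (f : α → QProg β) (F : β → ℝ)
    (h : ∀ a, D.StateFree (f a) F) (hP : ∀ G, D.StateFree P G) : D.StateFree (P.bind f) F := by
  intro ψ
  rw [D.expect_bind P f F h, D.expect_bind P f F h, hP]

end QDevice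

end Weight

/-! ### Properties that hold along every branch of an algorithm -/

/-- `P.Always t S`: in every branch of `P`, the output and the number of experiments performed,
counted from `t`, satisfy `S`. -/
def QProg.Always {α : Type} : QProg α → ℕ → (α → ℕ → Prop) → Prop
  | .ret a, t, S => S a t
  | .reset k, t, S => k.Always t S
  | .gate g k, t, S => k.Always (t + g.cost) S
  | .measureM k, t, S => ∀ x, (k x).Always (t + 1) S
  | .measureFlag k, t, S => ∀ i, (k i).Always t S
  | .unif _ _ k, t, S => ∀ n, (k n).Always t S

namespace QProg

variable {α β : Type}

theorem Always.mono {P : QProg α} {t : ℕ} {S T : α → ℕ → Prop} (h : P.Always t S)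
    (hST : ∀ a t', S a t' → T a t') : P.Always t T := by
  induction P generalizing t with
  | ret a => exact hST _ _ h
  | reset k ih => exact ih h
  | gate g k ih => exact ih h
  | measureM k ih => exact fun x => ih x (h x)
  | measureFlag k ih => exact fun x => ih x (h x)
  | unif s hs k ih => exact fun x => ih x (h x)

theorem Always.bind {P : QProg α} {f : α → QProg β} {t : ℕ} {S : α → ℕ → Prop}
    {T : β → ℕ → Prop} (h : P.Always t S) (hf : ∀ a t', S a t' → (f a).Always t' T) :
    (P.bind f).Always t T := by
  induction P generalizing t with
  | ret a => exact hf _ _ h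
  | reset k ih => exact ih h
  | gate g k ih => exact ih h
  | measureM k ih => exact fun x => ih x (h x)
  | measureFlag k ih => exact fun x => ih x (h x)
  | unif s hs k ih => exact fun x => ih x (h x)

/-- Experiments spent plus experiments reported as left never exceed the budget; an interrupted run
reports none left. -/
theorem always_interrupt (P : QProg α) (r t : ℕ) :
    (P.interrupt r).Always t fun o t' => t' + o.elim 0 Prod.snd ≤ t + r := by
  induction P generalizing r t with
  | ret a => simp [interrupt, Always]
  | reset k ih => exact ih _ _
  | gate g k ih =>
    rw [interrupt]
    split_ifs with h
    · exact (ih (r - g.cost) (t + g.cost)).mono fun a t' h' => by omega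
    · simp [Always]
  | measureM k ih =>
    rw [interrupt]
    split_ifs with h
    · exact fun x => (ih x (r - 1) (t + 1)).mono fun a t' h' => by omega
    · simp [Always]
  | measureFlag k ih => exact fun x => ih x _ _
  | unif s hs k ih => exact fun x => ih x _ _

theorem always_climb (fuel r l : ℕ) (y : EReal) (t : ℕ) :
    (climb fuel r l y).Always t fun _ t' => t' ≤ t + r := by
  induction fuel generalizing r l y t with
  | zero => simp [climb, Always]
  | succ fuel ih =>
    rw [climb]
    refine (always_interrupt (samplingRound l y) r t).bind ?_
    rintro (_ | ⟨(_ | x), r'⟩) t' h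
    · simpa [Always] using h
    · exact (ih r' (l + 1) y t').mono fun _ _ h' => by simp at h; omega
    · exact (ih r' 0 x t').mono fun _ _ h' => by simp at h; omega

theorem always_replicate {P : QProg α} {r : ℕ} (h : ∀ t, P.Always t fun _ t' => t' ≤ t + r)
    (m t : ℕ) : (replicate m P).Always t fun _ t' => t' ≤ t + m * r := by
  induction m generalizing t with
  | zero => simp [replicate, Always]
  | succ m ih =>
    refine (h t).bind fun a t' h' => (ih t').bind fun l t'' h'' => ?_
    simp only [Always]
    linarith [Nat.succ_mul m r]

end QProg

theorem always_quantileAlgorithm (c' p δ : ℝ) :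
    (quantileAlgorithm c' p δ).Always 0 fun _ t =>
      t ≤ ⌈6 * Real.logb 2 (1 / δ)⌉₊ * ⌈c' / Real.sqrt p⌉₊ := by
  refine (QProg.always_replicate (QProg.always_climb _ _ 0 ⊥) _ 0).bind fun l t h => ?_
  simpa [QProg.Always] using h

theorem QDevice.prob_eq_of_always {H : Type*} [NormedAddCommGroup H] [InnerProductSpace ℂ H]
    [FiniteDimensional ℂ H] (D : QDevice H) {α : Type} {P : QProg α} {t : ℕ}
    {S : α → ℕ → Prop} (h : P.Always t S) (ψ : Register H) :
    D.prob P ψ t S = D.expect P ψ fun _ => 1 := by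
  induction P generalizing ψ t with
  | ret a => simp only [QProg.Always] at h; simp [prob, expect, h]
  | reset k ih => exact ih h _
  | gate g k ih => exact ih h _
  | measureM k ih => exact Finset.sum_congr rfl fun x _ => ih x (h x) _
  | measureFlag k ih => exact Finset.sum_congr rfl fun x _ => ih x (h x) _
  | unif s hs k ih =>
    exact congrArg (· / (s.card : ℝ)) (Finset.sum_congr rfl fun x _ => ih x (h x) _)

/-! ### Amplitude amplification -/

section Amplification

variable {Ω : Type*} [Fintype Ω]
  {H : Type*} [NormedAddCommGroup H] [InnerProductSpace ℂ H] [FiniteDimensional ℂ H]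

open Classical in
/-- `Pr[X > y]`. -/
noncomputable def FiniteRV.probGT (X : FiniteRV Ω) (y : EReal) : ℝ :=
  ∑ ω with y < (X.val ω : EReal), X.pmf ω

/-- The amplitudes, after `n` iterations of amplitude amplification, of the good and the bad
components of a state whose good component has squared norm `s`. -/
noncomputable def amplitudes (s : ℝ) : ℕ → ℝ × ℝ
  | 0 => (1, 1)
  | n + 1 =>
    ((amplitudes s n).1 + 2 * ((amplitudes s n).2 * (1 - s) - (amplitudes s n).1 * s),
      2 * ((amplitudes s n).2 * (1 - s) - (amplitudes s n).1 * s) - (amplitudes s n).2)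

open Classical in
/-- The component `∑ √Pr(ω) |ω⟩` over the `ω` with `P ω`. -/
noncomputable def component (b : OrthonormalBasis Ω ℂ H) (X : FiniteRV Ω) (P : Ω → Prop) : H :=
  ∑ ω with P ω, ((Real.sqrt (X.pmf ω) : ℝ) : ℂ) • b ω

omit [FiniteDimensional ℂ H] in
open Classical in
theorem norm_component_sq (b : OrthonormalBasis Ω ℂ H) (X : FiniteRV Ω) (P : Ω → Prop) :
    ‖component b X P‖ ^ 2 = ∑ ω with P ω, X.pmf ω := by
  have h := b.orthonormal.inner_sum (fun ω => ((Real.sqrt (X.pmf ω) : ℝ) : ℂ))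
    (fun ω => ((Real.sqrt (X.pmf ω) : ℝ) : ℂ)) (Finset.univ.filter P)
  have h2 : inner ℂ (component b X P) (component b X P) = ((∑ ω with P ω, X.pmf ω : ℝ) : ℂ) := by
    rw [component, h, Complex.ofReal_sum]
    refine Finset.sum_congr rfl fun ω _ => ?_
    rw [Complex.conj_ofReal, ← Complex.ofReal_mul, Real.mul_self_sqrt (X.pmf_nonneg ω)]
  rw [inner_self_eq_norm_sq_to_K] at h2
  refine Complex.ofReal_injective ?_
  rw [Complex.ofReal_pow]
  exact h2

theorem QVariable.Generates.M_component {V : QVariable H} {b : OrthonormalBasis Ω ℂ H}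
    {X : FiniteRV Ω} (hV : V.Generates b X) {x : ℝ} (hx : x ∈ V.E) (P : Ω → Prop) :
    V.M x (component b X P) = component b X (fun ω => P ω ∧ X.val ω = x) := by
  classical
  rw [hV.M_eq x hx]
  have h : ∀ ω, inner ℂ (b ω) (component b X P) =
      if P ω then ((Real.sqrt (X.pmf ω) : ℝ) : ℂ) else 0 := by
    intro ω
    simp only [component, inner_sum, inner_smul_right, orthonormal_iff_ite.1 b.orthonormal,
      mul_ite, mul_one, mul_zero, Finset.sum_ite_eq, Finset.mem_filter, Finset.mem_univ, true_and]
  simp only [h, ite_smul, zero_smul]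
  rw [component, ← Finset.sum_filter, Finset.filter_filter]
  refine Finset.sum_congr ?_ fun _ _ => rfl
  ext ω
  simp [and_comm]

/-- The component of the sampler's output that is flagged by `1`. -/
noncomputable def goodPart (b : OrthonormalBasis Ω ℂ H) (X : FiniteRV Ω) (y : EReal) :
    H ⊗[ℂ] Qubit :=
  component b X (fun ω => y < (X.val ω : EReal)) ⊗ₜ[ℂ] ket 1

/-- The component of the sampler's output that is flagged by `0`. -/
noncomputable def badPart (b : OrthonormalBasis Ω ℂ H) (X : FiniteRV Ω) (y : EReal) :
    H ⊗[ℂ] Qubit :=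
  component b X (fun ω => ¬ y < (X.val ω : EReal)) ⊗ₜ[ℂ] ket 0

omit [FiniteDimensional ℂ H] in
theorem norm_goodPart_sq (b : OrthonormalBasis Ω ℂ H) (X : FiniteRV Ω) (y : EReal) :
    ‖goodPart b X y‖ ^ 2 = X.probGT y := by
  simp [goodPart, norm_component_sq, FiniteRV.probGT]
  congr!

omit [FiniteDimensional ℂ H] in
theorem norm_badPart_sq (b : OrthonormalBasis Ω ℂ H) (X : FiniteRV Ω) (y : EReal) :
    ‖badPart b X y‖ ^ 2 = 1 - X.probGT y := by
  classical
  have h := Finset.sum_filter_add_sum_filter_not Finset.univ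
    (fun ω => y < (X.val ω : EReal)) X.pmf
  rw [X.pmf_sum] at h
  rw [FiniteRV.probGT, ← h]
  simp [badPart, norm_component_sq]
  congr!

omit [FiniteDimensional ℂ H] in
theorem inner_good_bad (b : OrthonormalBasis Ω ℂ H) (X : FiniteRV Ω) (y : EReal) :
    inner ℂ (goodPart b X y) (badPart b X y) = 0 := by
  simp [goodPart, badPart, TensorProduct.inner_tmul, EuclideanSpace.inner_single_left]

theorem sampler_zeroState {b : OrthonormalBasis Ω ℂ H} {X : FiniteRV Ω} {D : QDevice H}
    (hD : D.toQVariable.Generates b X) (hC : IsComparisonOracle b X D.C) {y : EReal}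
    (hy : y < ⊤) :
    D.oracleMap (.comp y ⊤) (D.oracleMap .prep D.zeroState) = goodPart b X y + badPart b X y := by
  classical
  have h1 : D.oracleMap .prep D.zeroState =
      ∑ ω, ((Real.sqrt (X.pmf ω) : ℝ) : ℂ) • (b ω ⊗ₜ[ℂ] ket 0) := by
    change D.U D.ket0 ⊗ₜ[ℂ] ket 0 = _
    simp only [hD.U_ket0, TensorProduct.sum_tmul, TensorProduct.smul_tmul']
  rw [h1, map_sum, ← Finset.sum_filter_add_sum_filter_not Finset.univ
    (fun ω => y < (X.val ω : EReal))]
  simp only [map_smul, QDevice.oracleMap, hC y ⊤ hy, goodPart, badPart, component,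
    TensorProduct.sum_tmul, le_top, and_true]
  congr 1
  · refine Finset.sum_congr (by congr) fun ω hω => ?_
    rw [if_pos (Finset.mem_filter.1 hω).2, TensorProduct.smul_tmul']
  · refine Finset.sum_congr (by congr) fun ω hω => ?_
    rw [if_neg (Finset.mem_filter.1 hω).2, TensorProduct.smul_tmul']

/-! ### Lists of gates: norm preservation, cost, and action on the good and bad parts -/

namespace QDevice

variable (D : QDevice H)

/-- The state obtained by applying a list of gates. -/
noncomputable def run (l : List Gate) (ψ : Register H) : Register H :=
  l.foldl (fun φ g => D.gateMap g φ) ψ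

theorem run_append (l l' : List Gate) (ψ : Register H) :
    D.run (l ++ l') ψ = D.run l' (D.run l ψ) := List.foldl_append

theorem run_flatten_replicate (l : List Gate) (n : ℕ) (ψ : Register H) :
    D.run (List.replicate n l).flatten ψ = (D.run l)^[n] ψ := by
  induction n generalizing ψ with
  | zero => rfl
  | succ n ih => rw [List.replicate_succ, List.flatten_cons, run_append, ih]; rfl

/-- Since the gates preserve norms, it does not matter at which gate the budget runs out: the
interrupted branch has the same weight. -/
theorem expect_interrupt_gates {α : Type} (l : List Gate) (k : QProg α) (r : ℕ)
    (ψ : Register H) (F : Option (α × ℕ) → ℝ)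
    (hl : ∀ g ∈ l, ∀ φ : Register H, ‖D.gateMap g φ‖ = ‖φ‖) :
    D.expect ((QProg.gates l k).interrupt r) ψ F =
      if (l.map Gate.cost).sum ≤ r then
        D.expect (k.interrupt (r - (l.map Gate.cost).sum)) (D.run l ψ) F
      else ‖ψ‖ ^ 2 * F none := by
  induction l generalizing r ψ with
  | nil => simp [QProg.gates, run]
  | cons g l ih =>
    rw [QProg.gates, QProg.interrupt]
    by_cases hg : g.cost ≤ r
    · rw [if_pos hg, expect, ih _ _ fun g' hg' => hl g' (List.mem_cons_of_mem _ hg'),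
        hl g List.mem_cons_self]
      simp only [List.map_cons, List.sum_cons, run, List.foldl_cons, Nat.sub_sub]
      exact if_congr (by omega) rfl rfl
    · rw [if_neg hg, if_neg (by simp only [List.map_cons, List.sum_cons]; omega), expect]

theorem norm_gateMap_oracle (o : Oracle) (i : Bool) (φ : Register H) :
    ‖D.gateMap (.oracle o i false) φ‖ = ‖φ‖ :=
  TensorProduct.norm_map
    (if i then (D.oracleMap o).symm else D.oracleMap o).toLinearIsometry LinearIsometry.id φ

theorem norm_gateMap_flag (W : Qubit ≃ₗᵢ[ℂ] Qubit) (φ : Register H) :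
    ‖D.gateMap (.flag W) φ‖ = ‖φ‖ :=
  TensorProduct.norm_map
    (TensorProduct.mapIsometry (LinearIsometry.id : H →ₗᵢ[ℂ] H) W.toLinearIsometry)
    LinearIsometry.id φ

theorem norm_zeroState : ‖D.zeroState‖ = 1 := by simp [zeroState, D.norm_ket0]

theorem norm_gateMap_reflectZero (φ : Register H) :
    ‖D.gateMap .reflectZero φ‖ = ‖φ‖ := by
  have h : (2 : ℂ) • (InnerProductSpace.rankOne ℂ D.zeroState D.zeroState).toLinearMap
      - LinearMap.id = (ℂ ∙ D.zeroState).reflection.toLinearIsometry.toLinearMap := by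
    refine LinearMap.ext fun v => ?_
    simp [Submodule.reflection_apply, Submodule.starProjection_unit_singleton ℂ D.norm_zeroState,
      two_smul]
  rw [gateMap, h]
  exact TensorProduct.norm_map _ LinearIsometry.id φ

theorem norm_gateMap_amplification (y : EReal) (n : ℕ) :
    ∀ g ∈ amplificationGates y n, ∀ φ : Register H, ‖D.gateMap g φ‖ = ‖φ‖ := by
  intro g hg φ
  simp only [amplificationGates, samplerGates, samplerInvGates, List.mem_append,
    List.mem_flatten, List.mem_replicate, List.mem_cons, List.not_mem_nil, or_false] at hg
  rcases hg with (rfl | rfl) | ⟨l, ⟨-, rfl⟩, hg⟩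
  · exact D.norm_gateMap_oracle _ _ _
  · exact D.norm_gateMap_oracle _ _ _
  · simp only [List.mem_append, List.mem_cons, List.not_mem_nil, or_false] at hg
    rcases hg with ((rfl | rfl | rfl) | rfl) | rfl | rfl
    · exact D.norm_gateMap_flag _ _
    · exact D.norm_gateMap_oracle _ _ _
    · exact D.norm_gateMap_oracle _ _ _
    · exact D.norm_gateMap_reflectZero _
    · exact D.norm_gateMap_oracle _ _ _
    · exact D.norm_gateMap_oracle _ _ _

end QDevice

theorem amplificationGates_cost (y : EReal) (n : ℕ) :
    ((amplificationGates y n).map Gate.cost).sum = 4 * n + 2 := by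
  have h : ∀ (l : List Gate), ((List.replicate n l).flatten.map Gate.cost).sum
      = n * (l.map Gate.cost).sum := by
    intro l
    induction n with
    | zero => simp
    | succ n ih =>
      simp only [List.replicate_succ, List.flatten_cons, List.map_append, List.sum_append, ih]
      ring
  rw [amplificationGates, List.map_append, List.sum_append, h]
  simp [samplerGates, samplerInvGates, Gate.cost]
  ring

theorem QDevice.run_samplerGates (D : QDevice H) (y : EReal) (v : H ⊗[ℂ] Qubit) :
    D.run (samplerGates y) (v ⊗ₜ[ℂ] ket 0) =
      D.oracleMap (.comp y ⊤) (D.oracleMap .prep v) ⊗ₜ[ℂ] ket 0 := rfl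

theorem QDevice.run_samplerInvGates (D : QDevice H) (y : EReal) (v : H ⊗[ℂ] Qubit) :
    D.run (samplerInvGates y) (v ⊗ₜ[ℂ] ket 0) =
      (D.oracleMap .prep).symm ((D.oracleMap (.comp y ⊤)).symm v) ⊗ₜ[ℂ] ket 0 := rfl

theorem QDevice.run_reflectZero (D : QDevice H) (v : H ⊗[ℂ] Qubit) :
    D.run [.reflectZero] (v ⊗ₜ[ℂ] ket 0) =
      ((2 * inner ℂ D.zeroState v) • D.zeroState - v) ⊗ₜ[ℂ] ket 0 := by
  simp [run, gateMap, smul_smul]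

theorem flagReflection_ket_zero : flagReflection (ket 0) = ket 0 := by
  ext i; fin_cases i <;> simp [flagReflection]

theorem flagReflection_ket_one : flagReflection (ket 1) = (-1 : ℂ) • ket 1 := by
  ext i; fin_cases i <;> simp [flagReflection]

theorem QDevice.run_flagReflection (D : QDevice H) (b : OrthonormalBasis Ω ℂ H)
    (X : FiniteRV Ω) (y : EReal) (g h : ℂ) :
    D.run [.flag flagReflection] ((g • goodPart b X y + h • badPart b X y) ⊗ₜ[ℂ] ket 0) =
      (-g • goodPart b X y + h • badPart b X y) ⊗ₜ[ℂ] ket 0 := by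
  have h1 : TensorProduct.map LinearMap.id flagReflection.toLinearEquiv.toLinearMap
      (g • goodPart b X y + h • badPart b X y) = -g • goodPart b X y + h • badPart b X y := by
    rw [map_add, map_smul, map_smul, goodPart, badPart, TensorProduct.map_tmul,
      TensorProduct.map_tmul]
    simp only [LinearMap.id_apply, LinearEquiv.coe_coe, LinearIsometryEquiv.coe_toLinearEquiv,
      flagReflection_ket_zero, flagReflection_ket_one, TensorProduct.tmul_smul]
    module
  exact congrArg (· ⊗ₜ[ℂ] ket 0) h1

/-- The state after `n` iterations of amplitude amplification. -/
noncomputable def amplifiedState (b : OrthonormalBasis Ω ℂ H) (X : FiniteRV Ω) (y : EReal)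
    (n : ℕ) : H ⊗[ℂ] Qubit :=
  ((amplitudes (X.probGT y) n).1 : ℂ) • goodPart b X y
    + ((amplitudes (X.probGT y) n).2 : ℂ) • badPart b X y

theorem inner_add_linearCombination {E : Type*} [NormedAddCommGroup E] [InnerProductSpace ℂ E]
    {u v : E} (huv : inner ℂ u v = 0) (g h : ℂ) :
    inner ℂ (u + v) (g • u + h • v) = g * (‖u‖ ^ 2 : ℝ) + h * (‖v‖ ^ 2 : ℝ) := by
  have hvu : inner ℂ v u = 0 := inner_eq_zero_symm.1 huv
  simp [huv, hvu, inner_self_eq_norm_sq_to_K]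

omit [FiniteDimensional ℂ H] in
theorem inner_add_amplified (b : OrthonormalBasis Ω ℂ H) (X : FiniteRV Ω) (y : EReal)
    (g h : ℂ) :
    inner ℂ (goodPart b X y + badPart b X y) (g • goodPart b X y + h • badPart b X y) =
      g * X.probGT y + h * (1 - X.probGT y : ℝ) := by
  rw [← norm_badPart_sq b, ← norm_goodPart_sq b]
  exact inner_add_linearCombination (inner_good_bad b X y) g h

/-- Both reflections preserve the span of the good and bad parts, so an iteration is a linear
recursion on two coefficients, namely that of `amplitudes`. -/
theorem run_amplificationGates {b : OrthonormalBasis Ω ℂ H} {X : FiniteRV Ω} {D : QDevice H}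
    (hD : D.toQVariable.Generates b X) (hC : IsComparisonOracle b X D.C) {y : EReal}
    (hy : y < ⊤) (n : ℕ) :
    D.run (amplificationGates y n) D.init = amplifiedState b X y n ⊗ₜ[ℂ] ket 0 := by
  have h0 := sampler_zeroState hD hC hy
  rw [amplificationGates, D.run_append, D.run_flatten_replicate, QDevice.init,
    D.run_samplerGates, h0]
  induction n with
  | zero => simp [amplifiedState, amplitudes]
  | succ n ih =>
    rw [Function.iterate_succ_apply', ih]
    simp only [D.run_append, amplifiedState]
    rw [D.run_flagReflection, D.run_samplerInvGates, D.run_reflectZero, D.run_samplerGates]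
    congr 1
    -- Conjugation by `V` turns the reflection about `|0⟩` into the one about `V|0⟩`, the sum of the
    -- good and bad parts.
    have hin : ∀ v, inner ℂ D.zeroState
        ((D.oracleMap .prep).symm ((D.oracleMap (.comp y ⊤)).symm v)) =
        inner ℂ (goodPart b X y + badPart b X y) v := by
      intro v
      rw [← h0, ← LinearIsometryEquiv.inner_map_map (D.oracleMap .prep),
        ← LinearIsometryEquiv.inner_map_map (D.oracleMap (.comp y ⊤))]
      simp
    rw [hin, inner_add_amplified]
    simp only [map_sub, map_smul, h0, LinearIsometryEquiv.apply_symm_apply, amplitudes]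
    push_cast
    module

end Amplification

/-! ### One-step recursion for the output law of the climb -/

section Climb

variable {Ω : Type*} [Fintype Ω]
  {H : Type*} [NormedAddCommGroup H] [InnerProductSpace ℂ H] [FiniteDimensional ℂ H]

omit [FiniteDimensional ℂ H] in
theorem flag_zero_amplifiedState (b : OrthonormalBasis Ω ℂ H) (X : FiniteRV Ω) (y : EReal)
    (n : ℕ) :
    TensorProduct.map LinearMap.id (qubitProj 0) (amplifiedState b X y n) =
      ((amplitudes (X.probGT y) n).2 : ℂ) • badPart b X y := by
  rw [amplifiedState, map_add, map_smul, map_smul, goodPart, badPart, TensorProduct.map_tmul,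
    TensorProduct.map_tmul]
  simp [qubitProj, EuclideanSpace.inner_single_left]

omit [FiniteDimensional ℂ H] in
theorem flag_one_amplifiedState (b : OrthonormalBasis Ω ℂ H) (X : FiniteRV Ω) (y : EReal)
    (n : ℕ) :
    TensorProduct.map LinearMap.id (qubitProj 1) (amplifiedState b X y n) =
      ((amplitudes (X.probGT y) n).1 : ℂ) • goodPart b X y := by
  rw [amplifiedState, map_add, map_smul, map_smul, goodPart, badPart, TensorProduct.map_tmul,
    TensorProduct.map_tmul]
  simp [qubitProj, EuclideanSpace.inner_single_left]

omit [FiniteDimensional ℂ H] in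
theorem norm_smul_tmul_ket_sq (a : ℝ) (v : H ⊗[ℂ] Qubit) :
    ‖((a : ℂ) • v) ⊗ₜ[ℂ] ket 0‖ ^ 2 = a ^ 2 * ‖v‖ ^ 2 := by
  rw [TensorProduct.norm_tmul, TensorProduct.norm_smul_eq]
  simp [mul_pow]

open Classical in
theorem norm_measured_sq {b : OrthonormalBasis Ω ℂ H} {X : FiniteRV Ω} {V : QVariable H}
    (hV : V.Generates b X) (y : EReal) (a : ℝ) {x : ℝ} (hx : x ∈ V.E) :
    ‖TensorProduct.map (TensorProduct.map (V.M x) LinearMap.id) LinearMap.id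
        ((((a : ℂ) • goodPart b X y) ⊗ₜ[ℂ] ket 0 : Register H))‖ ^ 2 =
      a ^ 2 * ∑ ω with y < (X.val ω : EReal) ∧ X.val ω = x, X.pmf ω := by
  have h : TensorProduct.map (TensorProduct.map (V.M x) LinearMap.id) LinearMap.id
        ((((a : ℂ) • goodPart b X y) ⊗ₜ[ℂ] ket 0 : Register H)) =
      (((a : ℂ) • (component b X (fun ω => y < (X.val ω : EReal) ∧ X.val ω = x)
        ⊗ₜ[ℂ] ket 1)) ⊗ₜ[ℂ] ket 0 : Register H) := by
    rw [TensorProduct.map_tmul, map_smul, goodPart, TensorProduct.map_tmul,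
      hV.M_component hx]
    rfl
  rw [h, norm_smul_tmul_ket_sq, TensorProduct.norm_tmul, mul_pow, norm_component_sq]
  simp only [PiLp.norm_single, norm_one, one_pow, mul_one]
  congr!

open Classical in
/-- The expected value of `F` at the result of a sampling round with `n` iterations that is
interrupted after `r` experiments. -/
noncomputable def roundValue (X : FiniteRV Ω) (y : EReal) (r : ℕ)
    (F : Option (Option ℝ × ℕ) → ℝ) (n : ℕ) : ℝ :=
  if 4 * n + 2 ≤ r then
    (amplitudes (X.probGT y) n).2 ^ 2 * (1 - X.probGT y) * F (some (none, r - (4 * n + 2)))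
      + if 1 ≤ r - (4 * n + 2) then
          (amplitudes (X.probGT y) n).1 ^ 2 * ∑ ω with y < (X.val ω : EReal),
            X.pmf ω * F (some (some (X.val ω), r - (4 * n + 2) - 1))
        else (amplitudes (X.probGT y) n).1 ^ 2 * X.probGT y * F none
  else F none

variable {b : OrthonormalBasis Ω ℂ H} {X : FiniteRV Ω} {D : QDevice H}

open Classical in
theorem expect_samplingRound (hD : D.toQVariable.Generates b X)
    (hC : IsComparisonOracle b X D.C) (l : ℕ) {y : EReal} (hy : y < ⊤) (r : ℕ)
    (F : Option (Option ℝ × ℕ) → ℝ) :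
    D.expect ((samplingRound l y).interrupt r) D.init F =
      (∑ n ∈ iterationRange (l + 1), roundValue X y r F n) /
        ((iterationRange (l + 1)).card : ℝ) := by
  simp only [samplingRound, QProg.interrupt, QDevice.expect]
  refine congrArg (· / ((iterationRange (l + 1)).card : ℝ)) (Finset.sum_congr rfl fun n _ => ?_)
  have h1 : (((‖D.init‖ : ℝ) : ℂ) • D.init) = D.init := by simp
  rw [h1, D.expect_interrupt_gates _ _ _ _ _ (D.norm_gateMap_amplification y n),
    amplificationGates_cost, run_amplificationGates hD hC hy, roundValue]
  refine if_congr Iff.rfl ?_ (by simp)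
  set k := r - (4 * n + 2)
  have hz := flag_zero_amplifiedState b X y n
  have ho := flag_one_amplifiedState b X y n
  simp only [QProg.interrupt, QDevice.expect, Fin.sum_univ_two, TensorProduct.map_tmul]
  rw [hz, ho, if_neg (by decide), if_pos trivial]
  simp only [QProg.interrupt, QDevice.expect, LinearMap.id_apply]
  rw [norm_smul_tmul_ket_sq, norm_badPart_sq]
  congr 1
  by_cases hk : 1 ≤ k
  · rw [if_pos hk, if_pos hk, QDevice.expect]
    have h2 : ∀ x ∈ D.E, D.expect ((QProg.ret (some (some x, k - 1)) :
          QProg (Option (Option ℝ × ℕ))))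
        (TensorProduct.map (TensorProduct.map (D.M x) LinearMap.id) LinearMap.id
          ((((amplitudes (X.probGT y) n).1 : ℂ) • goodPart b X y) ⊗ₜ[ℂ] ket 0 : Register H)) F =
        (amplitudes (X.probGT y) n).1 ^ 2 *
          ∑ ω ∈ Finset.univ.filter (fun ω => y < (X.val ω : EReal)) with X.val ω = x,
            X.pmf ω * F (some (some (X.val ω), k - 1)) := by
      intro x hx
      rw [QDevice.expect, norm_measured_sq hD y _ hx, mul_assoc, Finset.sum_mul,
        Finset.filter_filter]
      congr 1
      refine Finset.sum_congr rfl fun ω hω => ?_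
      rw [(Finset.mem_filter.1 hω).2.2]
    refine (Finset.sum_congr rfl h2).trans ?_
    -- Summing over measurement outcomes regroups the sample points by their value.
    rw [← Finset.mul_sum, Finset.sum_fiberwise_of_maps_to fun ω _ => hD.val_mem ω]
  · rw [if_neg hk, if_neg hk, QDevice.expect, norm_smul_tmul_ket_sq, norm_goodPart_sq]

theorem stateFree_interrupt_samplingRound (l r : ℕ) (y : EReal)
    (F : Option (Option ℝ × ℕ) → ℝ) :
    D.StateFree ((samplingRound l y).interrupt r) F :=
  D.stateFree_unif _ _ _ _ fun _ => D.stateFree_reset _ _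

theorem stateFree_climb (fuel r l : ℕ) (y : EReal) (F : EReal → ℝ) :
    D.StateFree (climb fuel r l y) F := by
  induction fuel generalizing r l y with
  | zero => exact D.stateFree_ret _ _
  | succ fuel ih =>
    refine D.stateFree_bind _ _ _ ?_ (stateFree_interrupt_samplingRound l r y)
    rintro (_ | ⟨(_ | x), r'⟩)
    · exact D.stateFree_ret _ _
    · exact ih _ _ _
    · exact ih _ _ _

theorem expect_climb_zero (r l : ℕ) (y : EReal) (F : EReal → ℝ) :
    D.expect (climb 0 r l y) D.init F = F y := by
  simp [climb, QDevice.expect]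

open Classical in
/-- The expected value of `F` at the output of a climb whose first round has `n` iterations. -/
noncomputable def climbValue (D : QDevice H) (X : FiniteRV Ω) (F : EReal → ℝ) (fuel r l : ℕ)
    (y : EReal) (n : ℕ) : ℝ :=
  if 4 * n + 2 ≤ r then
    (amplitudes (X.probGT y) n).2 ^ 2 * (1 - X.probGT y) *
        D.expect (climb fuel (r - (4 * n + 2)) (l + 1) y) D.init F
      + if 1 ≤ r - (4 * n + 2) then
          (amplitudes (X.probGT y) n).1 ^ 2 * ∑ ω with y < (X.val ω : EReal),
            X.pmf ω * D.expect (climb fuel (r - (4 * n + 2) - 1) 0 (X.val ω)) D.init F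
        else (amplitudes (X.probGT y) n).1 ^ 2 * X.probGT y * F y
  else F y

theorem expect_climb_succ (hD : D.toQVariable.Generates b X)
    (hC : IsComparisonOracle b X D.C) (fuel r l : ℕ) {y : EReal} (hy : y < ⊤)
    (F : EReal → ℝ) :
    D.expect (climb (fuel + 1) r l y) D.init F =
      (∑ n ∈ iterationRange (l + 1), climbValue D X F fuel r l y n) /
        ((iterationRange (l + 1)).card : ℝ) := by
  rw [climb, D.expect_bind, expect_samplingRound hD hC l hy]
  · simp only [roundValue, climbValue, QDevice.expect, QDevice.norm_init, one_pow, one_mul]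
  · rintro (_ | ⟨(_ | x), r'⟩)
    · exact D.stateFree_ret _ _
    · exact stateFree_climb _ _ _ _ _
    · exact stateFree_climb _ _ _ _ _

end Climb

/-! ### The success probability and the cost of sequential amplitude amplification -/

/-- With `s = sin² θ`, the good and bad parts have norms `|sin θ|` and `|cos θ|`, and each iteration
rotates their plane by `2θ`. -/
theorem amplitudes_mul_trig (θ : ℝ) (n : ℕ) :
    (amplitudes (Real.sin θ ^ 2) n).1 * Real.sin θ = Real.sin ((2 * n + 1) * θ) ∧
      (amplitudes (Real.sin θ ^ 2) n).2 * Real.cos θ = Real.cos ((2 * n + 1) * θ) := by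
  induction n with
  | zero => simp [amplitudes]
  | succ n ih =>
    obtain ⟨h1, h2⟩ := ih
    set φ := (2 * (n : ℝ) + 1) * θ with hφ
    have hm : (amplitudes (Real.sin θ ^ 2) n).2 * (1 - Real.sin θ ^ 2)
        - (amplitudes (Real.sin θ ^ 2) n).1 * Real.sin θ ^ 2 = Real.cos (φ + θ) := by
      rw [Real.cos_add, ← h1, ← h2, ← Real.cos_sq']; ring
    have e : (2 * ((n + 1 : ℕ) : ℝ) + 1) * θ = (φ + θ) + θ := by rw [hφ]; push_cast; ring
    have e1 : Real.sin φ = Real.sin (φ + θ) * Real.cos θ - Real.cos (φ + θ) * Real.sin θ := by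
      rw [← Real.sin_sub]; ring_nf
    have e2 : Real.cos φ = Real.cos (φ + θ) * Real.cos θ + Real.sin (φ + θ) * Real.sin θ := by
      rw [← Real.cos_sub]; ring_nf
    simp only [amplitudes, hm]
    rw [e, Real.sin_add (φ + θ), Real.cos_add (φ + θ)]
    constructor
    · linear_combination h1 + e1
    · linear_combination -h2 - e2

theorem exists_sin_sq {s : ℝ} (h0 : 0 ≤ s) (h1 : s ≤ 1) :
    ∃ θ, Real.sin θ = √s ∧ Real.cos θ = √(1 - s) := by
  have hs : √s ≤ 1 := Real.sqrt_le_one.2 h1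
  refine ⟨Real.arcsin (√s), Real.sin_arcsin (by linarith [Real.sqrt_nonneg s]) hs, ?_⟩
  rw [Real.cos_arcsin, Real.sq_sqrt h0]

theorem amplitudes_sq_add_sq {s : ℝ} (h0 : 0 ≤ s) (h1 : s ≤ 1) (n : ℕ) :
    (amplitudes s n).2 ^ 2 * (1 - s) + (amplitudes s n).1 ^ 2 * s = 1 := by
  obtain ⟨θ, hsin, hcos⟩ := exists_sin_sq h0 h1
  have h := amplitudes_mul_trig θ n
  have hs : Real.sin θ ^ 2 = s := by rw [hsin, Real.sq_sqrt h0]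
  have hc : Real.cos θ ^ 2 = 1 - s := by rw [hcos, Real.sq_sqrt (by linarith)]
  rw [hs] at h
  rw [← hc]
  nth_rw 3 [← hs]
  rw [← mul_pow, ← mul_pow, h.1, h.2]
  exact Real.cos_sq_add_sin_sq _

/-- Each iteration adds twice a cosine to the coefficient. This holds even when `s = 0`, where
dividing by `sin θ` is impossible. -/
theorem abs_amplitudes_fst_le {s : ℝ} (h0 : 0 ≤ s) (h1 : s ≤ 1) (n : ℕ) :
    |(amplitudes s n).1| ≤ 2 * n + 1 := by
  obtain ⟨θ, hsin, hcos⟩ := exists_sin_sq h0 h1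
  have hs : Real.sin θ ^ 2 = s := by rw [hsin, Real.sq_sqrt h0]
  induction n with
  | zero => simp [amplitudes]
  | succ n ih =>
    obtain ⟨h1, h2⟩ := amplitudes_mul_trig θ n
    rw [hs] at h1 h2
    have hm : (amplitudes s n).2 * (1 - s) - (amplitudes s n).1 * s =
        Real.cos ((2 * n + 1) * θ + θ) := by
      rw [Real.cos_add, ← h1, ← h2, ← hs, ← Real.cos_sq']; ring
    simp only [amplitudes, hm]
    have hb := abs_le.1 (Real.abs_cos_le_one ((2 * n + 1) * θ + θ))
    rw [abs_le] at ih ⊢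
    push_cast
    constructor <;> linarith [hb.1, hb.2, ih.1, ih.2]

/-- The sum of `sin² ((2n+1)θ)` telescopes after multiplication by `sin 2θ`. -/
theorem sum_amplitudes_mul_sin (θ : ℝ) {a c : ℕ} (hac : a ≤ c) :
    4 * Real.sin (2 * θ) *
        ∑ n ∈ Finset.Ico a c, (amplitudes (Real.sin θ ^ 2) n).1 ^ 2 * Real.sin θ ^ 2 =
      2 * ((c : ℝ) - a) * Real.sin (2 * θ) - (Real.sin (4 * c * θ) - Real.sin (4 * a * θ)) := by
  induction c, hac using Nat.le_induction with
  | base => simp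
  | succ c hac ih =>
    rw [Finset.sum_Ico_succ_top hac, mul_add, ih, ← mul_pow, (amplitudes_mul_trig θ c).1]
    have e1 : 4 * ((c + 1 : ℕ) : ℝ) * θ = 2 * ((2 * c + 1) * θ) + 2 * θ := by push_cast; ring
    have e2 : 4 * (c : ℝ) * θ = 2 * ((2 * c + 1) * θ) - 2 * θ := by ring
    rw [e1, e2, Real.sin_add, Real.sin_sub, Real.cos_two_mul ((2 * c + 1) * θ)]
    push_cast
    linear_combination (4 * Real.sin (2 * θ)) *
      Real.sin_sq_add_cos_sq ((2 * c + 1) * θ)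

/-- Over a long enough range of iteration numbers, the average success probability is at least
`1 / 4`. -/
theorem le_sum_success {s : ℝ} (h0 : 0 < s) (h1 : s < 1) {a c : ℕ}
    (hac : 1 ≤ (√s * √(1 - s)) * ((c : ℝ) - a)) :
    ((c : ℝ) - a) / 4 ≤ ∑ n ∈ Finset.Ico a c, (amplitudes s n).1 ^ 2 * s := by
  obtain ⟨θ, hsin, hcos⟩ := exists_sin_sq h0.le h1.le
  have hs : Real.sin θ ^ 2 = s := by rw [hsin, Real.sq_sqrt h0.le]
  have hq : 0 < √s * √(1 - s) := mul_pos (Real.sqrt_pos.2 h0) (Real.sqrt_pos.2 (by linarith))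
  have hac' : a ≤ c := by
    by_contra h
    have : (c : ℝ) - a < 0 := by
      have : (c : ℝ) < a := by exact_mod_cast not_le.1 h
      linarith
    nlinarith
  have h := sum_amplitudes_mul_sin θ hac'
  have h2 : Real.sin (2 * θ) = 2 * (√s * √(1 - s)) := by rw [Real.sin_two_mul, hsin, hcos]; ring
  rw [hs, h2] at h
  have b1 := Real.sin_le_one (4 * c * θ)
  have b2 := Real.neg_one_le_sin (4 * a * θ)
  set q := √s * √(1 - s)
  set T := ∑ n ∈ Finset.Ico a c, (amplitudes s n).1 ^ 2 * s
  have h3 : q * (((c : ℝ) - a) / 4) ≤ q * T := by nlinarith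
  exact le_of_mul_le_mul_left h3 hq

theorem card_iterationRange (l : ℕ) :
    ((iterationRange (l + 1)).card : ℝ) = (⌈(1.1 : ℝ) ^ (l + 1)⌉₊ : ℝ) - ⌊(1.1 : ℝ) ^ l⌋₊ := by
  have h := iterationRange_nonempty (l + 1) (by omega)
  rw [iterationRange, Finset.nonempty_Ico] at h
  rw [iterationRange, Nat.card_Ico, Nat.cast_sub h.le]
  simp

theorem card_iterationRange_pos (l : ℕ) : (0 : ℝ) < (iterationRange (l + 1)).card := by
  exact_mod_cast (iterationRange_nonempty (l + 1) (by omega)).card_pos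

theorem le_card_iterationRange (l : ℕ) :
    (1.1 : ℝ) ^ l / 10 ≤ (iterationRange (l + 1)).card := by
  rw [card_iterationRange]
  have h1 := Nat.le_ceil ((1.1 : ℝ) ^ (l + 1))
  have h2 := Nat.floor_le (show (0 : ℝ) ≤ (1.1 : ℝ) ^ l by positivity)
  have h3 : (1.1 : ℝ) ^ (l + 1) = 1.1 ^ l * 1.1 := pow_succ _ _
  linarith

theorem cost_le_of_mem_iterationRange {l n : ℕ} (hn : n ∈ iterationRange (l + 1)) :
    4 * (n : ℝ) + 3 ≤ 8 * (1.1 : ℝ) ^ l := by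
  have h1 := Nat.lt_ceil.1 (Finset.mem_Ico.1 hn).2
  have h2 : (1 : ℝ) ≤ (1.1 : ℝ) ^ l := one_le_pow₀ (by norm_num)
  rw [pow_succ] at h1
  linarith

theorem iterationRange_one : iterationRange 1 = {1} := by
  have h : ⌈(1.1 : ℝ)⌉₊ = 2 := by rw [Nat.ceil_eq_iff (by norm_num)]; norm_num
  simp only [iterationRange, Nat.sub_self, pow_zero, Nat.floor_one, pow_one, h]
  rfl

/-- A bound `S l` for the expected number of experiments of sequential amplitude amplification
from its stage `l + 1` on, when the good component has squared norm `s`. -/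
theorem exists_stage_cost {s : ℝ} (h0 : 0 < s) (h1 : s ≤ 1) :
    ∃ S : ℕ → ℝ, (∀ l, 0 ≤ S l) ∧ S 0 ≤ 13000 / √s ∧
      ∀ l, ∑ n ∈ iterationRange (l + 1),
          (4 * (n : ℝ) + 3 + (amplitudes s n).2 ^ 2 * (1 - s) * S (l + 1)) ≤
        (iterationRange (l + 1)).card * S l := by
  have hsq : 0 < √s := Real.sqrt_pos.2 h0
  have hsq1 : √s ≤ 1 := Real.sqrt_le_one.2 h1
  have hcost : ∀ l, ∑ n ∈ iterationRange (l + 1), (4 * (n : ℝ) + 3) ≤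
      (iterationRange (l + 1)).card * (8 * (1.1 : ℝ) ^ l) := by
    intro l
    rw [← nsmul_eq_mul]
    exact Finset.sum_le_card_nsmul _ _ _ fun n hn => cost_le_of_mem_iterationRange hn
  -- For `s = 1` the bad part vanishes and a round never fails, so `S` only has to pay for one
  -- round.
  rcases eq_or_lt_of_le h1 with rfl | hs1
  · refine ⟨fun l => 8 * (1.1 : ℝ) ^ l, fun l => by positivity, by simp; norm_num, fun l => ?_⟩
    simpa using hcost l
  have hsq' : 0 < √(1 - s) := Real.sqrt_pos.2 (by linarith)
  have hsq1' : √(1 - s) ≤ 1 := Real.sqrt_le_one.2 (by linarith)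
  set q := √s * √(1 - s) with hq
  have hqpos : 0 < q := mul_pos hsq hsq'
  have hq1 : q ≤ 1 := mul_le_one₀ hsq1 hsq'.le hsq1'
  -- The index `k + 1` is critical: from `l = k + 1` on, the range has at least `1.1^l / 10 ≥ 1/q`
  -- elements, so `le_sum_success` applies.
  obtain ⟨k, hk1, hk2⟩ := exists_nat_pow_near (x := 10 / q) (y := (1.1 : ℝ))
    (by rw [le_div_iff₀ hqpos]; linarith) (by norm_num)
  have hpow : ∀ l, (1 : ℝ) ≤ 1.1 ^ l := fun l => one_le_pow₀ (by norm_num)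
  -- Before the critical index no success is assumed, and `S l - S (l + 1) = 8 · 1.1^l` pays for the
  -- round. Afterwards `S l = 50 · 1.1^l`, and failure probability at most `3/4` suffices since `8 +
  -- (3/4) · 55 ≤ 50`.
  set S : ℕ → ℝ := fun l => 130 * (1.1 : ℝ) ^ (max l (k + 1)) - 80 * (1.1 : ℝ) ^ l with hS
  have hSnn : ∀ l, 0 ≤ S l := by
    intro l
    have : (1.1 : ℝ) ^ l ≤ 1.1 ^ (max l (k + 1)) :=
      pow_le_pow_right₀ (by norm_num) (le_max_left _ _)
    simp only [hS]
    linarith [hpow l]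
  have hfail : ∀ l, ∑ n ∈ iterationRange (l + 1), (amplitudes s n).2 ^ 2 * (1 - s) =
      (iterationRange (l + 1)).card - ∑ n ∈ iterationRange (l + 1), (amplitudes s n).1 ^ 2 * s := by
    intro l
    rw [eq_sub_iff_add_eq, ← Finset.sum_add_distrib,
      Finset.sum_congr rfl fun n _ => amplitudes_sq_add_sq h0.le h1 n]
    simp
  have hstep : ∀ l, ∑ n ∈ iterationRange (l + 1),
          (4 * (n : ℝ) + 3 + (amplitudes s n).2 ^ 2 * (1 - s) * S (l + 1)) ≤
        (iterationRange (l + 1)).card * S l := by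
    intro l
    rw [Finset.sum_add_distrib, ← Finset.sum_mul, hfail]
    have hc := hcost l
    have hcard := card_iterationRange_pos l
    have hnn : 0 ≤ ∑ n ∈ iterationRange (l + 1), (amplitudes s n).1 ^ 2 * s :=
      Finset.sum_nonneg fun n _ => by positivity
    by_cases hl : l < k + 1
    · have e1 : max l (k + 1) = k + 1 := max_eq_right hl.le
      have e2 : max (l + 1) (k + 1) = k + 1 := max_eq_right hl
      have hSS : S l = 8 * (1.1 : ℝ) ^ l + S (l + 1) := by
        simp only [hS, e1, e2]
        rw [pow_succ (1.1 : ℝ) l]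
        ring
      rw [hSS]
      nlinarith [mul_nonneg hnn (hSnn (l + 1))]
    · have e1 : max l (k + 1) = l := max_eq_left (by omega)
      have e2 : max (l + 1) (k + 1) = l + 1 := max_eq_left (by omega)
      have hlarge : 10 / q ≤ (1.1 : ℝ) ^ l :=
        hk2.le.trans (pow_le_pow_right₀ (by norm_num) (by omega))
      rw [div_le_iff₀ hqpos] at hlarge
      have hsucc : ((iterationRange (l + 1)).card : ℝ) / 4 ≤
          ∑ n ∈ iterationRange (l + 1), (amplitudes s n).1 ^ 2 * s := by
        have hw := le_card_iterationRange l
        have hw' : 1 ≤ q * ((iterationRange (l + 1)).card : ℝ) := by nlinarith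
        rw [card_iterationRange] at hw' ⊢
        exact le_sum_success h0 hs1 hw'
      have hSl : S l = 50 * (1.1 : ℝ) ^ l := by simp only [hS, e1]; ring
      have hSl1 : S (l + 1) = 55 * (1.1 : ℝ) ^ l := by
        simp only [hS, e2]; rw [pow_succ (1.1 : ℝ) l]; ring
      rw [hSl, hSl1]
      have hx := hpow l
      set x := (1.1 : ℝ) ^ l
      set N := ((iterationRange (l + 1)).card : ℝ)
      have h3 : (N - ∑ n ∈ iterationRange (l + 1), (amplitudes s n).1 ^ 2 * s) * (55 * x) ≤
          (3 / 4 * N) * (55 * x) := mul_le_mul_of_nonneg_right (by linarith) (by positivity)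
      nlinarith [mul_nonneg hcard.le (by linarith : (0 : ℝ) ≤ x)]
  -- `S` is of order `1/q`, which blows up as `s` tends to `1`. The first round always has `n = 1`
  -- and fails with probability at most `9 (1 - s)`; this factor cancels the blow-up.
  refine ⟨fun l => if l = 0 then 8 + 9 * (1 - s) * S 1 else S l, fun l => ?_, ?_, fun l => ?_⟩
  · dsimp only
    split_ifs
    · have := hSnn 1
      have : 0 ≤ 1 - s := by linarith
      positivity
    · exact hSnn l
  · have hS1 : S 1 ≤ 1430 / q := by
      have e1 : max 1 (k + 1) = k + 1 := max_eq_right (by omega)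
      have : 1430 / q = 143 * (10 / q) := by ring
      simp only [hS, e1]
      rw [pow_succ, this]
      nlinarith
    have h3 : (1 - s) * (1430 / q) ≤ 1430 / √s := by
      have h4 : 1 - s = √(1 - s) * √(1 - s) := (Real.mul_self_sqrt (by linarith)).symm
      have h5 : (1 - s) * (1430 / q) = 1430 / √s * √(1 - s) := by
        rw [hq]
        nth_rw 1 [h4]
        field_simp
      rw [h5]
      exact mul_le_of_le_one_right (by positivity) hsq1'
    have h6 : (8 : ℝ) ≤ 8 / √s := by rw [le_div_iff₀ hsq]; linarith
    have h7 : (1 - s) * S 1 ≤ (1 - s) * (1430 / q) :=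
      mul_le_mul_of_nonneg_left hS1 (by linarith)
    have h8 : 13000 / √s = 8 / √s + 9 * (1430 / √s) + 122 / √s := by ring
    have h9 : 0 ≤ 122 / √s := by positivity
    simp only [if_true]
    rw [h8]
    linarith
  · rcases Nat.eq_zero_or_pos l with rfl | hl
    · rw [zero_add, iterationRange_one]
      simp only [Finset.sum_singleton, Finset.card_singleton, if_true, one_ne_zero, if_false,
        amplitudes]
      -- The bad coefficient after one iteration is `1 - 4s`, which lies in `[-3, 1]`.
      have h3 : (2 * (1 * (1 - s) - 1 * s) - 1) ^ 2 ≤ 9 := by nlinarith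
      have h4 : (2 * (1 * (1 - s) - 1 * s) - 1) ^ 2 * ((1 - s) * S 1) ≤ 9 * ((1 - s) * S 1) :=
        mul_le_mul_of_nonneg_right h3 (mul_nonneg (by linarith) (hSnn 1))
      push_cast
      linarith
    · simpa [hl.ne'] using hstep l

/-! ### Analysis of the climb -/

section Analysis

variable {Ω : Type*} [Fintype Ω]
  {H : Type*} [NormedAddCommGroup H] [InnerProductSpace ℂ H] [FiniteDimensional ℂ H]
  {b : OrthonormalBasis Ω ℂ H} {X : FiniteRV Ω} {D : QDevice H}

theorem FiniteRV.probGT_nonneg (X : FiniteRV Ω) (y : EReal) : 0 ≤ X.probGT y :=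
  Finset.sum_nonneg fun ω _ => X.pmf_nonneg ω

theorem FiniteRV.probGT_anti (X : FiniteRV Ω) {y z : EReal} (h : y ≤ z) :
    X.probGT z ≤ X.probGT y := by
  classical
  refine Finset.sum_le_sum_of_subset_of_nonneg ?_ fun ω _ _ => X.pmf_nonneg ω
  intro ω hω
  simp only [Finset.mem_filter, Finset.mem_univ, true_and] at hω ⊢
  exact h.trans_lt hω

theorem FiniteRV.probGT_bot (X : FiniteRV Ω) : X.probGT ⊥ = 1 := by
  simp [FiniteRV.probGT, X.pmf_sum]

theorem FiniteRV.probGT_le_one (X : FiniteRV Ω) (y : EReal) : X.probGT y ≤ 1 :=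
  X.probGT_bot ▸ X.probGT_anti bot_le

theorem expect_climb_one (hD : D.toQVariable.Generates b X)
    (hC : IsComparisonOracle b X D.C) (fuel r l : ℕ) {y : EReal} (hy : y < ⊤) :
    D.expect (climb fuel r l y) D.init (fun _ => 1) = 1 := by
  induction fuel generalizing r l y with
  | zero => exact expect_climb_zero _ _ _ _
  | succ fuel ih =>
    rw [expect_climb_succ hD hC _ _ _ hy, div_eq_one_iff_eq (card_iterationRange_pos l).ne']
    have h : ∀ n ∈ iterationRange (l + 1),
        climbValue D X (fun _ => 1) fuel r l y n = 1 := by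
      intro n _
      have h1 := amplitudes_sq_add_sq (X.probGT_nonneg y) (X.probGT_le_one y) n
      simp only [climbValue, ih _ _ hy, ih _ _ (EReal.coe_lt_top _), mul_one]
      split_ifs
      · exact h1
      · exact h1
      · rfl
    rw [Finset.sum_congr rfl h]
    simp

theorem expect_climb_le_one (hD : D.toQVariable.Generates b X)
    (hC : IsComparisonOracle b X D.C) (fuel r l : ℕ) {y : EReal} (hy : y < ⊤)
    {F : EReal → ℝ} (hF : ∀ z, F z ≤ 1) :
    D.expect (climb fuel r l y) D.init F ≤ 1 :=
  (D.expect_mono _ _ hF).trans_eq (expect_climb_one hD hC fuel r l hy)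

open Classical in
/-- A climb started below `z` and interrupted after `r` experiments passes `z` with probability at
most `Pr[X > z] r² / 4`. -/
theorem expect_climb_gt_le (hD : D.toQVariable.Generates b X)
    (hC : IsComparisonOracle b X D.C) (z : EReal) (fuel r l : ℕ) {y : EReal} (hy : y < ⊤)
    (hyz : y ≤ z) :
    D.expect (climb fuel r l y) D.init (fun x => if z < x then 1 else 0) ≤
      X.probGT z * (r : ℝ) ^ 2 / 4 := by
  have hq := X.probGT_nonneg z
  induction fuel generalizing r l y with
  | zero => rw [expect_climb_zero, if_neg hyz.not_gt]; positivity
  | succ fuel ih =>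
    rw [expect_climb_succ hD hC _ _ _ hy, div_le_iff₀ (card_iterationRange_pos l), mul_comm,
      ← nsmul_eq_mul]
    refine Finset.sum_le_card_nsmul _ _ _ fun n _ => ?_
    have hs0 := X.probGT_nonneg y
    have hs1 := X.probGT_le_one y
    rw [climbValue]
    have h1 := amplitudes_sq_add_sq hs0 hs1 n
    have hg : (amplitudes (X.probGT y) n).1 ^ 2 ≤ (2 * n + 1) ^ 2 :=
      sq_le_sq' (abs_le.1 (abs_amplitudes_fst_le hs0 hs1 n)).1
        (abs_le.1 (abs_amplitudes_fst_le hs0 hs1 n)).2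
    have hg0 : 0 ≤ (amplitudes (X.probGT y) n).1 ^ 2 := sq_nonneg _
    have hh0 : 0 ≤ (amplitudes (X.probGT y) n).2 ^ 2 * (1 - X.probGT y) :=
      mul_nonneg (sq_nonneg _) (by linarith)
    set g2 := (amplitudes (X.probGT y) n).1 ^ 2
    set f := (amplitudes (X.probGT y) n).2 ^ 2 * (1 - X.probGT y)
    set q := X.probGT z
    split_ifs with hr hk hzy
    · have hb := ih (r - (4 * n + 2)) (l + 1) hy hyz
      obtain ⟨k, rfl⟩ := Nat.exists_eq_add_of_le hr
      rw [Nat.add_sub_cancel_left] at hb hk ⊢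
      -- A sample above `z` is charged in full, for a total of at most `q`; a sample at most `z` is
      -- charged by induction.
      have hsum : ∑ ω with y < (X.val ω : EReal), X.pmf ω *
            D.expect (climb fuel (k - 1) 0 (X.val ω)) D.init (fun x => if z < x then 1 else 0) ≤
          X.probGT y * (q * (k : ℝ) ^ 2 / 4) + q := by
        have hpt : ∀ ω, X.pmf ω * D.expect (climb fuel (k - 1) 0 (X.val ω)) D.init
              (fun x => if z < x then 1 else 0) ≤
            X.pmf ω * (q * (k : ℝ) ^ 2 / 4) +
              if z < (X.val ω : EReal) then X.pmf ω else 0 := by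
          intro ω
          have hp := X.pmf_nonneg ω
          split_ifs with hz
          · have h2 := expect_climb_le_one hD hC fuel (k - 1) 0 (EReal.coe_lt_top (X.val ω))
              (F := fun x => if z < x then 1 else 0) (fun x => by split_ifs <;> norm_num)
            have h3 : 0 ≤ X.pmf ω * (q * (k : ℝ) ^ 2 / 4) := by positivity
            nlinarith
          · have h2 := ih (k - 1) 0 (EReal.coe_lt_top (X.val ω)) (not_lt.1 hz)
            have h3 : ((k - 1 : ℕ) : ℝ) ^ 2 ≤ (k : ℝ) ^ 2 := by
              gcongr; omega
            rw [add_zero]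
            refine mul_le_mul_of_nonneg_left (h2.trans ?_) hp
            gcongr
        refine (Finset.sum_le_sum fun ω _ => hpt ω).trans ?_
        rw [Finset.sum_add_distrib, ← Finset.sum_mul, FiniteRV.probGT]
        refine add_le_add le_rfl ?_
        rw [← Finset.sum_filter, Finset.filter_filter]
        refine Finset.sum_le_sum_of_subset_of_nonneg ?_ fun ω _ _ => X.pmf_nonneg ω
        intro ω hω
        simp only [Finset.mem_filter, Finset.mem_univ, true_and] at hω ⊢
        exact hω.2
      have h4 : f * D.expect (climb fuel k (l + 1) y) D.init (fun x => if z < x then 1 else 0)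
          ≤ f * (q * (k : ℝ) ^ 2 / 4) := mul_le_mul_of_nonneg_left hb hh0
      have h5 := mul_le_mul_of_nonneg_left hsum hg0
      -- The round contributes at most `q (4n + 2)² / 4` and the rest `q k² / 4`; together they are
      -- at most `q (4n + 2 + k)² / 4`.
      have h6 : g2 * q ≤ (2 * n + 1) ^ 2 * q := mul_le_mul_of_nonneg_right hg hq
      have h7 : f * (q * (k : ℝ) ^ 2 / 4) + g2 * X.probGT y * (q * (k : ℝ) ^ 2 / 4) =
          q * (k : ℝ) ^ 2 / 4 := by rw [← add_mul, h1, one_mul]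
      have h8 : 0 ≤ q * (n * k : ℝ) := by positivity
      have h9 : 0 ≤ q * (k : ℝ) := by positivity
      push_cast
      nlinarith
    · exact absurd hzy hyz.not_gt
    -- The budget does not allow the final measurement, so a flagged outcome leaves the value at
    -- `y`, which is not above `z`.
    · have hb := ih (r - (4 * n + 2)) (l + 1) hy hyz
      obtain ⟨k, rfl⟩ := Nat.exists_eq_add_of_le hr
      rw [Nat.add_sub_cancel_left] at hb ⊢
      have h4 : f * D.expect (climb fuel k (l + 1) y) D.init (fun x => if z < x then 1 else 0)
          ≤ 1 * (q * (k : ℝ) ^ 2 / 4) := by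
        refine mul_le_mul ?_ hb ?_ zero_le_one
        · have := mul_nonneg hg0 hs0; linarith
        · have h0 := D.expect_mono (climb fuel k (l + 1) y) D.init
            (F := fun _ => 0) (G := fun x => if z < x then 1 else 0)
            (fun x => by split_ifs <;> norm_num)
          have h0' := D.expect_linear (climb fuel k (l + 1) y) D.init
            (fun _ => 0) (fun _ => 0) 0 0
          simp only [zero_mul, add_zero] at h0'
          rwa [h0'] at h0
      have h5 : (k : ℝ) ^ 2 ≤ ((4 * n + 2 + k : ℕ) : ℝ) ^ 2 := by gcongr; omega
      have h6 := mul_le_mul_of_nonneg_left h5 hq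
      linarith
    · exact absurd ‹_› hyz.not_gt
    · positivity

/-! The number of experiments needed to reach `Pr[X > y] < p` is controlled by the potential
`remaining p A s`, where `s = Pr[X > y]` and `A / √s` bounds the cost of a conditional sample. -/

/-- The bound for the remaining number of experiments. -/
noncomputable def remaining (p A s : ℝ) : ℝ := if p ≤ s then 2 * A / √p - A / √s else 0

/-- The antiderivative of `remaining`. -/
noncomputable def remainingInt (p A s : ℝ) : ℝ := if p ≤ s then 2 * A * s / √p - 2 * A * √s else 0

theorem remainingInt_nonneg {p A s : ℝ} (hp : 0 < p) (hA : 0 ≤ A) : 0 ≤ remainingInt p A s := by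
  rw [remainingInt]
  split_ifs with h
  · have h1 : √p ≤ √s := Real.sqrt_le_sqrt h
    have hp' : 0 < √p := Real.sqrt_pos.2 hp
    have h2 : √s * √p ≤ s := (mul_le_mul_of_nonneg_left h1 (Real.sqrt_nonneg s)).trans_eq
      (Real.mul_self_sqrt (hp.le.trans h))
    rw [sub_nonneg, le_div_iff₀ hp']
    nlinarith
  · exact le_rfl

/-- The function `remaining` is nondecreasing on the range that matters, so a rectangle with the
height of its left end lies under the graph. For `u < p` that height is `0`. -/
theorem mul_remaining_le {p A u v : ℝ} (hp : 0 < p) (hA : 0 ≤ A) (huv : u ≤ v) :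
    (v - u) * remaining p A u + remainingInt p A u ≤ remainingInt p A v := by
  by_cases hu : p ≤ u
  · have hu' : 0 < √u := Real.sqrt_pos.2 (hp.trans_le hu)
    have huv' : √u ≤ √v := Real.sqrt_le_sqrt huv
    rw [remaining, remainingInt, remainingInt, if_pos hu, if_pos hu, if_pos (hu.trans huv)]
    have h1 : 2 * (√v - √u) ≤ (v - u) / √u := by
      rw [le_div_iff₀ hu']
      nlinarith [Real.mul_self_sqrt (hp.le.trans hu), Real.mul_self_sqrt
        (hp.le.trans (hu.trans huv)), mul_self_nonneg (√v - √u)]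
    have h2 := mul_le_mul_of_nonneg_left h1 hA
    have h3 : (v - u) * (2 * A / √p - A / √u) + (2 * A * u / √p - 2 * A * √u) =
        2 * A * v / √p - 2 * A * √u - A * ((v - u) / √u) := by ring
    rw [h3]
    linarith
  · rw [remaining, if_neg hu, mul_zero, zero_add]
    conv_lhs => rw [remainingInt, if_neg hu]
    exact remainingInt_nonneg hp hA

-- The left side is a lower Riemann sum: the atoms with value `x` have total mass the length of the
-- interval from `Pr[X > x]` to `Pr[X ≥ x]`, with height taken at the left end. The induction peels
-- off the smallest value above `y`.
open Classical in
theorem sum_remaining_le (X : FiniteRV Ω) {p A : ℝ} (hp : 0 < p) (hA : 0 ≤ A) (y : EReal) :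
    ∑ ω with y < (X.val ω : EReal), X.pmf ω * remaining p A (X.probGT (X.val ω)) ≤
      remainingInt p A (X.probGT y) := by
  induction hN : (Finset.univ.filter fun ω => y < (X.val ω : EReal)).card using
    Nat.strong_induction_on generalizing y with
  | _ N ih =>
    rcases (Finset.univ.filter fun ω => y < (X.val ω : EReal)).eq_empty_or_nonempty with he | hne
    · rw [he, Finset.sum_empty]
      exact remainingInt_nonneg hp hA
    · obtain ⟨ω₀, hω₀, hmin⟩ := Finset.exists_min_image _ X.val hne
      rw [Finset.mem_filter] at hω₀
      set x := X.val ω₀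
      have hlt : (Finset.univ.filter fun ω => (x : EReal) < (X.val ω : EReal)) ⊂
          Finset.univ.filter fun ω => y < (X.val ω : EReal) := by
        refine Finset.ssubset_iff_subset_ne.2 ⟨fun ω hω => ?_, fun h => ?_⟩
        · simp only [Finset.mem_filter, Finset.mem_univ, true_and] at hω ⊢
          exact hω₀.2.trans hω
        · have : ω₀ ∈ Finset.univ.filter fun ω => (x : EReal) < (X.val ω : EReal) := by
            rw [h]; simpa using hω₀.2
          simp [x] at this
      have hx := ih _ (hN ▸ Finset.card_lt_card hlt) (x : EReal) rfl
      have hsplit : ∀ f : Ω → ℝ, ∑ ω with y < (X.val ω : EReal), f ω =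
          ∑ ω ∈ (Finset.univ.filter fun ω => y < (X.val ω : EReal)) \
            (Finset.univ.filter fun ω => (x : EReal) < (X.val ω : EReal)), f ω +
          ∑ ω with (x : EReal) < (X.val ω : EReal), f ω :=
        fun f => (Finset.sum_sdiff hlt.subset).symm
      have hval : ∀ ω ∈ (Finset.univ.filter fun ω => y < (X.val ω : EReal)) \
            (Finset.univ.filter fun ω => (x : EReal) < (X.val ω : EReal)), X.val ω = x := by
        intro ω hω
        rw [Finset.mem_sdiff] at hω
        refine le_antisymm ?_ (hmin ω hω.1)
        simpa using hω.2
      rw [hsplit, Finset.sum_congr rfl fun ω hω => by rw [hval ω hω], ← Finset.sum_mul]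
      have hp' := hsplit X.pmf
      change X.probGT y = _ + X.probGT x at hp'
      rw [eq_sub_iff_add_eq.2 hp'.symm]
      exact (add_le_add le_rfl hx).trans
        (mul_remaining_le hp hA (X.probGT_anti hω₀.2.le))

-- The current value never decreases, so `Pr[X > y]` stays below `p` once it is there.
open Classical in
theorem expect_climb_low_eq_zero (hD : D.toQVariable.Generates b X)
    (hC : IsComparisonOracle b X D.C) {p : ℝ} (fuel r l : ℕ) {y : EReal} (hy : y < ⊤)
    (hyp : X.probGT y < p) :
    D.expect (climb fuel r l y) D.init (fun x => if p ≤ X.probGT x then 1 else 0) = 0 := by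
  induction fuel generalizing r l y with
  | zero => rw [expect_climb_zero, if_neg hyp.not_ge]
  | succ fuel ih =>
    rw [expect_climb_succ hD hC _ _ _ hy, Finset.sum_eq_zero, zero_div]
    intro n _
    have h1 : ∀ k, ∑ ω with y < (X.val ω : EReal), X.pmf ω *
        D.expect (climb fuel k 0 (X.val ω)) D.init
          (fun x => if p ≤ X.probGT x then 1 else 0) = 0 := by
      intro k
      refine Finset.sum_eq_zero fun ω hω => ?_
      rw [ih k 0 (EReal.coe_lt_top _)
        ((X.probGT_anti (Finset.mem_filter.1 hω).2.le).trans_lt hyp), mul_zero]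
    simp only [climbValue, h1, ih _ _ hy hyp, if_neg hyp.not_ge, mul_zero, add_zero, ite_self]

open Classical in
/-- A climb interrupted after `r` experiments fails to reach `Pr[X > y] < p` with probability at
most `1 / r` times the expected number of experiments needed. -/
theorem mul_expect_climb_low_le (hD : D.toQVariable.Generates b X)
    (hC : IsComparisonOracle b X D.C) {p A : ℝ} (hp : 0 < p) (hA : 0 ≤ A) (S : ℝ → ℕ → ℝ)
    (hS0 : ∀ s, p ≤ s → s ≤ 1 → ∀ l, 0 ≤ S s l)
    (hSA : ∀ s, p ≤ s → s ≤ 1 → S s 0 ≤ A / √s)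
    (hS : ∀ s, p ≤ s → s ≤ 1 → ∀ l, ∑ n ∈ iterationRange (l + 1),
      (4 * (n : ℝ) + 3 + (amplitudes s n).2 ^ 2 * (1 - s) * S s (l + 1)) ≤
        (iterationRange (l + 1)).card * S s l)
    (fuel r l : ℕ) (hr : r ≤ fuel) {y : EReal} (hy : y < ⊤) (hyp : p ≤ X.probGT y) :
    r * D.expect (climb fuel r l y) D.init (fun x => if p ≤ X.probGT x then 1 else 0) ≤
      S (X.probGT y) l + remainingInt p A (X.probGT y) / X.probGT y := by
  have hind : ∀ x, (if p ≤ X.probGT x then (1 : ℝ) else 0) ≤ 1 :=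
    fun x => by split_ifs <;> norm_num
  -- The fixed-point property behind `remaining`: one sample costs `A/√s`, the mean of `remaining`
  -- over `[0, s]` is `2A/√p - 2A/√s`, and these add up to `remaining` at `s`.
  have hsmall : ∀ s, p ≤ s → s ≤ 1 →
      S s 0 + remainingInt p A s / s ≤ remaining p A s := by
    intro s hs hs1
    have hs0 : 0 < s := hp.trans_le hs
    have h1 : √s / s = 1 / √s := Real.sqrt_div_self'
    have h2 : remainingInt p A s / s = 2 * A / √p - 2 * A * (√s / s) := by
      rw [remainingInt, if_pos hs]
      field_simp
    rw [h2, h1, remaining, if_pos hs]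
    have := hSA s hs hs1
    have h3 : 2 * A * (1 / √s) = A / √s + A / √s := by ring
    linarith
  induction fuel generalizing r l y with
  | zero =>
    obtain rfl : r = 0 := by omega
    have := hS0 _ hyp (X.probGT_le_one y) l
    have := div_nonneg (remainingInt_nonneg (s := X.probGT y) hp hA) (X.probGT_nonneg y)
    simp only [Nat.cast_zero, zero_mul]
    linarith
  | succ fuel ih =>
    have hs0 : 0 < X.probGT y := hp.trans_le hyp
    have hs1 := X.probGT_le_one y
    set s := X.probGT y with hs
    have hN0 : 0 ≤ remainingInt p A s / s :=
      div_nonneg (remainingInt_nonneg hp hA) hs0.le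
    have hSl := hS0 s hyp hs1 (l + 1)
    have hmain : ∀ n ∈ iterationRange (l + 1),
        r * climbValue D X (fun x => if p ≤ X.probGT x then 1 else 0) fuel r l y n ≤
          4 * (n : ℝ) + 3 + (amplitudes s n).2 ^ 2 * (1 - s) * S s (l + 1)
            + remainingInt p A s / s := by
      intro n _
      have h1 := amplitudes_sq_add_sq hs0.le hs1 n
      have hg0 : 0 ≤ (amplitudes s n).1 ^ 2 := sq_nonneg _
      have hf0 : 0 ≤ (amplitudes s n).2 ^ 2 * (1 - s) := mul_nonneg (sq_nonneg _) (by linarith)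
      rw [climbValue, ← hs, if_pos hyp]
      set g2 := (amplitudes s n).1 ^ 2
      set f := (amplitudes s n).2 ^ 2 * (1 - s)
      set N := remainingInt p A s / s with hN
      split_ifs with hrn hk
      · have hb := ih (r - (4 * n + 2)) (l + 1) (by omega) hy hyp
        obtain ⟨k, rfl⟩ := Nat.exists_eq_add_of_le hrn
        rw [Nat.add_sub_cancel_left] at hb hk ⊢
        have hb1 := expect_climb_le_one hD hC fuel k (l + 1) hy hind
        obtain ⟨k, rfl⟩ := Nat.exists_eq_add_of_le' hk
        rw [Nat.add_sub_cancel]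
        -- The budget splits into the `4n + 3` experiments of a successful round, for which the
        -- probability is bounded by `1`, and the remaining `k`, to which induction applies.
        have hsum : ((4 * n + 2 + (k + 1) : ℕ) : ℝ) *
            ∑ ω with y < (X.val ω : EReal), X.pmf ω *
              D.expect (climb fuel k 0 (X.val ω)) D.init
                (fun x => if p ≤ X.probGT x then 1 else 0) ≤
            (4 * n + 3) * s + s * N := by
          have hpt : ∀ ω ∈ Finset.univ.filter (fun ω => y < (X.val ω : EReal)),
              ((4 * n + 2 + (k + 1) : ℕ) : ℝ) * (X.pmf ω *
              D.expect (climb fuel k 0 (X.val ω)) D.init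
                (fun x => if p ≤ X.probGT x then 1 else 0)) ≤
              (4 * n + 3) * X.pmf ω +
                X.pmf ω * remaining p A (X.probGT (X.val ω)) := by
            intro ω _
            have hlt := EReal.coe_lt_top (X.val ω)
            have hE1 := expect_climb_le_one hD hC fuel k 0 hlt hind
            have hE2 : k * D.expect (climb fuel k 0 (X.val ω)) D.init
                (fun x => if p ≤ X.probGT x then 1 else 0) ≤
                remaining p A (X.probGT (X.val ω)) := by
              by_cases hω : p ≤ X.probGT (X.val ω)
              · exact (ih k 0 (by omega) hlt hω).trans (hsmall _ hω (X.probGT_le_one _))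
              · rw [expect_climb_low_eq_zero hD hC fuel k 0 hlt (not_le.1 hω), remaining,
                  if_neg hω, mul_zero]
            set E := D.expect (climb fuel k 0 (X.val ω)) D.init
                (fun x => if p ≤ X.probGT x then 1 else 0)
            have h2 : ((4 * n + 2 + (k + 1) : ℕ) : ℝ) * E ≤
                (4 * n + 3) + remaining p A (X.probGT (X.val ω)) := by
              push_cast
              have : (4 * (n : ℝ) + 3) * E ≤ (4 * n + 3) * 1 :=
                mul_le_mul_of_nonneg_left hE1 (by positivity)
              linarith
            have h3 := mul_le_mul_of_nonneg_left h2 (X.pmf_nonneg ω)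
            linarith
          rw [Finset.mul_sum]
          refine (Finset.sum_le_sum hpt).trans ?_
          rw [Finset.sum_add_distrib, ← Finset.mul_sum, hN, mul_div_cancel₀ _ hs0.ne']
          exact add_le_add le_rfl (sum_remaining_le X hp hA y)
        have h2 := mul_le_mul_of_nonneg_left hsum hg0
        set E := D.expect (climb fuel (k + 1) (l + 1) y) D.init
          (fun x => if p ≤ X.probGT x then 1 else 0)
        set T := ∑ ω with y < (X.val ω : EReal), X.pmf ω *
              D.expect (climb fuel k 0 (X.val ω)) D.init
                (fun x => if p ≤ X.probGT x then 1 else 0)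
        have h3 : ((4 * n + 2 + (k + 1) : ℕ) : ℝ) * E ≤ (4 * n + 3) + (S s (l + 1) + N) := by
          have : (4 * (n : ℝ) + 2) * E ≤ (4 * n + 2) * 1 :=
            mul_le_mul_of_nonneg_left hb1 (by positivity)
          push_cast at hb ⊢
          linarith
        have h4 := mul_le_mul_of_nonneg_left h3 hf0
        -- Failure and success have total weight `1`, so their common charge is paid once; only
        -- failure adds the cost of the next stage.
        have h5 : (4 * (n : ℝ) + 3 + N) * (f + g2 * s) = 4 * n + 3 + N := by
          rw [h1, mul_one]
        linarith
      · have hb := ih (r - (4 * n + 2)) (l + 1) (by omega) hy hyp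
        obtain ⟨k, rfl⟩ := Nat.exists_eq_add_of_le hrn
        rw [Nat.add_sub_cancel_left] at hb hk ⊢
        -- The budget was exactly `4n + 2`, so the bound `1` on the probability suffices.
        obtain rfl : k = 0 := by omega
        have hb1 := expect_climb_le_one hD hC fuel 0 (l + 1) hy hind
        have h2 := mul_le_mul_of_nonneg_left hb1 hf0
        have h3 := mul_nonneg hf0 hSl
        have h4 : f * D.expect (climb fuel 0 (l + 1) y) D.init
          (fun x => if p ≤ X.probGT x then 1 else 0) + g2 * s * 1 ≤ 1 := by linarith
        have h5 := mul_le_mul_of_nonneg_left h4 (Nat.cast_nonneg (α := ℝ) (4 * n + 2 + 0))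
        refine h5.trans ?_
        push_cast
        linarith
      · have h2 : (r : ℝ) ≤ 4 * n + 2 := by exact_mod_cast (not_le.1 hrn).le
        have h3 := mul_nonneg hf0 hSl
        linarith
    have hcard := card_iterationRange_pos l
    rw [expect_climb_succ hD hC _ _ _ hy, ← mul_div_assoc, div_le_iff₀ hcard, Finset.mul_sum]
    refine (Finset.sum_le_sum hmain).trans ?_
    rw [Finset.sum_add_distrib, Finset.sum_const, nsmul_eq_mul]
    have := hS s hyp hs1 l
    linarith

end Analysis

/-! ### Repetition and median -/

theorem listMedian_eq_getElem {l : List EReal} (hl : l ≠ []) :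
    ∃ s : List EReal, s.Perm l ∧ s.Pairwise (· ≤ ·) ∧ ∃ h : s.length / 2 < s.length,
      listMedian l = s[s.length / 2] := by
  refine ⟨l.mergeSort (fun a b => decide (a ≤ b)), List.mergeSort_perm _ _, ?_, ?_⟩
  · have h := List.pairwise_mergeSort (le := fun a b : EReal => decide (a ≤ b))
      (by simpa using fun a b c => le_trans) (by simpa using le_total) l
    simpa using h
  · have hpos := List.length_pos_iff.2 hl
    refine ⟨by rw [List.length_mergeSort]; omega, ?_⟩
    rw [listMedian, List.getD_eq_getElem _ _ (by rw [List.length_mergeSort]; omega)]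
    simp only [List.length_mergeSort]

/-- In the sorted list, every entry up to the median inherits `P`, and these are more than half. -/
theorem length_le_two_mul_countP_of_listMedian_lower {P : EReal → Prop} [DecidablePred P]
    (hP : ∀ a c, a ≤ c → P c → P a) {l : List EReal} (h : P (listMedian l)) :
    l.length ≤ 2 * l.countP (fun a => P a) := by
  rcases eq_or_ne l [] with rfl | hl
  · simp
  obtain ⟨s, hsl, hs, hlt, hm⟩ := listMedian_eq_getElem hl
  rw [hm] at h
  rw [← hsl.length_eq, ← hsl.countP_eq]
  have h1 : (s.take (s.length / 2 + 1)).countP (fun a => P a) =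
      (s.take (s.length / 2 + 1)).length := by
    refine List.countP_eq_length.2 fun a ha => decide_eq_true ?_
    obtain ⟨i, hi, rfl⟩ := List.mem_take_iff_getElem.1 ha
    refine hP _ _ ?_ h
    exact hs.rel_get_of_le (a := ⟨i, by omega⟩) (b := ⟨s.length / 2, hlt⟩)
      (Fin.mk_le_mk.2 (by omega))
  have h2 := (List.take_sublist (s.length / 2 + 1) s).countP_le (p := fun a => decide (P a))
  rw [h1, List.length_take] at h2
  omega

/-- The entries from the upper median on may be exactly half when the length is even, hence the
non-strict bound. -/
theorem length_le_two_mul_countP_of_listMedian_upper {P : EReal → Prop} [DecidablePred P]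
    (hP : ∀ a c, a ≤ c → P a → P c) {l : List EReal} (h : P (listMedian l)) :
    l.length ≤ 2 * l.countP (fun a => P a) := by
  rcases eq_or_ne l [] with rfl | hl
  · simp
  obtain ⟨s, hsl, hs, hlt, hm⟩ := listMedian_eq_getElem hl
  rw [hm] at h
  rw [← hsl.length_eq, ← hsl.countP_eq]
  have h1 : (s.drop (s.length / 2)).countP (fun a => P a) = (s.drop (s.length / 2)).length := by
    refine List.countP_eq_length.2 fun a ha => decide_eq_true ?_
    obtain ⟨i, hi, rfl⟩ := List.mem_drop_iff_getElem.1 ha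
    refine hP _ _ ?_ h
    exact hs.rel_get_of_le (a := ⟨s.length / 2, hlt⟩) (b := ⟨s.length / 2 + i, by omega⟩)
      (Fin.mk_le_mk.2 (by omega))
  have h2 := (List.drop_sublist (s.length / 2) s).countP_le (p := fun a => decide (P a))
  rw [h1, List.length_drop] at h2
  omega

/-- The weight of a list is at least `1` when at least half of its entries satisfy `P`. -/
theorem one_le_prod_of_length_le_two_mul_countP {α : Type*} {P : α → Prop}
    [DecidablePred P] {l : List α}
    (h : l.length ≤ 2 * l.countP (fun a => P a)) :
    1 ≤ (l.map fun a => (1 / 8 : ℝ) + 63 / 8 * if P a then 1 else 0).prod := by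
  -- An entry weighs `8` if it satisfies `P` and `1/8` otherwise; multiplying by `8 ^ l.length`
  -- avoids negative exponents.
  have h1 : (l.map fun a => (1 / 8 : ℝ) + 63 / 8 * if P a then 1 else 0).prod * 8 ^ l.length =
      8 ^ (2 * l.countP (fun a => P a)) := by
    clear h
    induction l with
    | nil => simp
    | cons a l ih =>
      rw [List.map_cons, List.prod_cons, List.length_cons, pow_succ, List.countP_cons, mul_add,
        pow_add, ← ih]
      by_cases ha : P a
      · simp only [ha, if_true, decide_true]; ring
      · simp only [ha, if_false, decide_false, Bool.false_eq_true]; ring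
  have h2 : (8 : ℝ) ^ l.length ≤ 8 ^ (2 * l.countP (fun a => P a)) :=
    pow_le_pow_right₀ (by norm_num) h
  rw [← h1] at h2
  exact (le_mul_iff_one_le_left (by positivity)).1 h2

section Replicate

variable {H : Type*} [NormedAddCommGroup H] [InnerProductSpace ℂ H] [FiniteDimensional ℂ H]
  (D : QDevice H) {α : Type}

namespace QDevice

theorem expect_mul_left (P : QProg α) (ψ : Register H) (x : ℝ) (F : α → ℝ) :
    D.expect P ψ (fun a => x * F a) = x * D.expect P ψ F := by
  simpa using D.expect_linear P ψ F F x 0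

theorem stateFree_replicate {P : QProg α} (hP : ∀ F, D.StateFree P F) (m : ℕ)
    (F : List α → ℝ) : D.StateFree (QProg.replicate m P) F := by
  induction m generalizing F with
  | zero => exact D.stateFree_ret _ _
  | succ m ih =>
    exact D.stateFree_bind _ _ _
      (fun a => D.stateFree_bind _ _ _ (fun l => D.stateFree_ret _ _) ih) hP

/-- State-freeness makes the repetitions independent, so expectations of products factor. -/
theorem expect_replicate {P : QProg α} (hP : ∀ F, D.StateFree P F) (m : ℕ) (h : α → ℝ) :
    D.expect (QProg.replicate m P) D.init (fun l => (l.map h).prod) =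
      D.expect P D.init h ^ m := by
  induction m with
  | zero => simp [QProg.replicate, expect]
  | succ m ih =>
    have hl : ∀ (a : α) (l : List α) (F : List α → ℝ),
        D.StateFree (QProg.ret (a :: l)) F := fun a l F => D.stateFree_ret _ _
    rw [QProg.replicate, D.expect_bind _ _ _ fun a =>
      D.stateFree_bind _ _ _ (fun l => hl a l _) (D.stateFree_replicate hP m)]
    have h1 : ∀ a, D.expect ((QProg.replicate m P).bind fun l => QProg.ret (a :: l)) D.init
        (fun l => (l.map h).prod) = D.expect P D.init h ^ m * h a := by
      intro a
      rw [D.expect_bind _ _ _ fun l => hl a l _]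
      simp only [expect, norm_init, one_pow, one_mul, List.map_cons, List.prod_cons]
      rw [expect_mul_left, ih, mul_comm]
    simp only [h1]
    rw [expect_mul_left, pow_succ]

end QDevice

end Replicate

/-! ### The quantile estimate -/

section Quantile

variable {Ω : Type*} [Fintype Ω]

theorem FiniteRV.le_probGT_of_lt_quantile (X : FiniteRV Ω) {p : ℝ} {y : EReal}
    (h : y < X.quantile p) : p ≤ X.probGT y := by
  classical
  obtain ⟨_, ⟨x, hx, rfl⟩, hyx⟩ := lt_sSup_iff.1 h
  refine le_trans (hx : p ≤ X.probGE x) ?_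
  refine Finset.sum_le_sum_of_subset_of_nonneg ?_ fun ω _ _ => X.pmf_nonneg ω
  intro ω hω
  simp only [Finset.mem_filter, Finset.mem_univ, true_and] at hω ⊢
  exact hyx.trans_le (EReal.coe_le_coe_iff.2 hω)

/-- If some value exceeds the quantile, the smallest such value `x` has `Pr[X ≥ x] < p`, and all
values above the quantile are at least `x`. -/
theorem FiniteRV.probGT_quantile_le (X : FiniteRV Ω) {p : ℝ} (hp : 0 ≤ p) :
    X.probGT (X.quantile p) ≤ p := by
  classical
  rcases (Finset.univ.filter fun ω => X.quantile p < (X.val ω : EReal)).eq_empty_or_nonempty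
    with he | hne
  · rw [FiniteRV.probGT]
    convert hp
    rw [Finset.sum_eq_zero]
    intro ω hω
    have : ω ∈ Finset.univ.filter fun ω => X.quantile p < (X.val ω : EReal) := by
      simpa using hω
    simp [he] at this
  · obtain ⟨ω₀, hω₀, hmin⟩ := Finset.exists_min_image _ X.val hne
    have h1 : X.probGE (X.val ω₀) < p := by
      by_contra h
      exact (Finset.mem_filter.1 hω₀).2.not_ge (le_sSup ⟨_, not_lt.1 h, rfl⟩)
    refine le_trans ?_ h1.le
    refine Finset.sum_le_sum_of_subset_of_nonneg ?_ fun ω _ _ => X.pmf_nonneg ω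
    intro ω hω
    have hω' : ω ∈ Finset.univ.filter fun ω => X.quantile p < (X.val ω : EReal) := by
      simpa using hω
    simpa using hmin ω hω'

variable {H : Type*} [NormedAddCommGroup H] [InnerProductSpace ℂ H] [FiniteDimensional ℂ H]
  {b : OrthonormalBasis Ω ℂ H} {X : FiniteRV Ω} {D : QDevice H}

-- From `-∞`, where `s = 1`, the expected cost is at most `26000/√p`; the budget constant is
-- `1664000 = 64 · 26000`.
open Classical in
theorem expect_climb_lt_quantile_le (hD : D.toQVariable.Generates b X)
    (hC : IsComparisonOracle b X D.C) {p : ℝ} (hp : 0 < p) (hp1 : p < 1) {r : ℕ}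
    (hr : 1664000 / √p ≤ r) :
    D.expect (climb r r 0 ⊥) D.init (fun x => if x < X.quantile p then 1 else 0) ≤ 1 / 64 := by
  choose! S hS0 hSA hS using fun (s : ℝ) (hs : p ≤ s) (hs1 : s ≤ 1) =>
    exists_stage_cost (hp.trans_le hs) hs1
  have h1 := mul_expect_climb_low_le hD hC hp (by norm_num : (0 : ℝ) ≤ 13000) S hS0 hSA hS
    r r 0 le_rfl bot_lt_top (by rw [X.probGT_bot]; exact hp1.le)
  rw [X.probGT_bot, div_one, remainingInt, if_pos hp1.le, Real.sqrt_one, mul_one] at h1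
  have h2 := hSA 1 hp1.le le_rfl
  rw [Real.sqrt_one, div_one] at h2
  have hp' : 0 < √p := Real.sqrt_pos.2 hp
  have h3 : D.expect (climb r r 0 ⊥) D.init (fun x => if x < X.quantile p then 1 else 0) ≤
      D.expect (climb r r 0 ⊥) D.init (fun x => if p ≤ X.probGT x then 1 else 0) := by
    refine D.expect_mono _ _ fun x => ?_
    split_ifs with hx hx'
    · exact le_rfl
    · exact absurd (X.le_probGT_of_lt_quantile hx) hx'
    · exact zero_le_one
    · exact le_rfl
  refine h3.trans ?_
  set E := D.expect (climb r r 0 ⊥) D.init (fun x => if p ≤ X.probGT x then 1 else 0)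
  have hr0 : 0 < (r : ℝ) := lt_of_lt_of_le (by positivity) hr
  have h4 : (r : ℝ) * E ≤ r * (1 / 64) := by
    have h5 : (2 * 13000 : ℝ) / √p = 1664000 / √p * (1 / 64) := by ring
    linarith
  exact le_of_mul_le_mul_left h4 hr0

-- The factor `1 / (16 (c' + 1)²)` is chosen so that the overshoot bound `Pr[X > z] r² / 4` becomes
-- `1/64`.
open Classical in
theorem expect_climb_quantile_lt_le (hD : D.toQVariable.Generates b X)
    (hC : IsComparisonOracle b X D.C) {p c' : ℝ} (hp : 0 < p) (hc' : 0 < c') {r : ℕ}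
    (hr : r ≤ (c' + 1) / √p) :
    D.expect (climb r r 0 ⊥) D.init
      (fun x => if X.quantile (1 / (16 * (c' + 1) ^ 2) * p) < x then 1 else 0) ≤ 1 / 64 := by
  refine (expect_climb_gt_le hD hC _ r r 0 bot_lt_top bot_le).trans ?_
  have hq : 0 ≤ 1 / (16 * (c' + 1) ^ 2) * p := by positivity
  have h1 := X.probGT_quantile_le hq
  have h2 : (r : ℝ) ^ 2 ≤ (c' + 1) ^ 2 / p := by
    refine (pow_le_pow_left₀ (Nat.cast_nonneg r) hr 2).trans_eq ?_
    rw [div_pow, Real.sq_sqrt hp.le]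
  have h3 := mul_le_mul h1 h2 (by positivity) hq
  have h4 : 1 / (16 * (c' + 1) ^ 2) * p * ((c' + 1) ^ 2 / p) = 1 / 16 := by
    field_simp
  linarith

theorem expect_quantileAlgorithm (c' p δ : ℝ) (F : EReal → ℝ) :
    D.expect (quantileAlgorithm c' p δ) D.init F =
      D.expect (QProg.replicate ⌈6 * Real.logb 2 (1 / δ)⌉₊
        (climb ⌈c' / Real.sqrt p⌉₊ ⌈c' / Real.sqrt p⌉₊ 0 ⊥)) D.init
        fun l => F (listMedian l) := by
  rw [quantileAlgorithm, D.expect_bind _ _ _ fun l => D.stateFree_ret _ _]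
  simp [QDevice.expect]

theorem expect_replicate_climb_one (hD : D.toQVariable.Generates b X)
    (hC : IsComparisonOracle b X D.C) (m fuel r : ℕ) :
    D.expect (QProg.replicate m (climb fuel r 0 ⊥)) D.init (fun _ => 1) = 1 := by
  have h := D.expect_replicate (stateFree_climb fuel r 0 ⊥) m (fun _ => 1)
  rw [expect_climb_one hD hC _ _ _ bot_lt_top, one_pow] at h
  simpa using h

/-- The mean weight of one entry is at most `1/8 + (63/8)(1/64) < 1/4`. -/
theorem expect_replicate_climb_le (hD : D.toQVariable.Generates b X)
    (hC : IsComparisonOracle b X D.C) (m fuel r : ℕ) {P : EReal → Prop}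
    [DecidablePred P]
    (hP : D.expect (climb fuel r 0 ⊥) D.init (fun x => if P x then 1 else 0) ≤ 1 / 64) :
    D.expect (QProg.replicate m (climb fuel r 0 ⊥)) D.init
      (fun l => (l.map fun a => (1 / 8 : ℝ) + 63 / 8 * if P a then 1 else 0).prod) ≤
      (1 / 4) ^ m := by
  rw [D.expect_replicate (stateFree_climb fuel r 0 ⊥)]
  have h0 : 0 ≤ D.expect (climb fuel r 0 ⊥) D.init (fun x => if P x then 1 else 0) := by
    have h := D.expect_mono (climb fuel r 0 ⊥) D.init (F := fun _ => 0 * 1)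
      (G := fun x => if P x then 1 else 0) (fun x => by split_ifs <;> norm_num)
    rwa [D.expect_mul_left, zero_mul] at h
  have h := D.expect_linear (climb fuel r 0 ⊥) D.init (fun _ => 1)
    (fun x => if P x then 1 else 0) (1 / 8) (63 / 8)
  rw [expect_climb_one hD hC _ _ _ bot_lt_top] at h
  simp only [mul_one] at h
  rw [h]
  exact pow_le_pow_left₀ (by linarith) (by linarith) m

end Quantile

/-! ### Numerical bounds and conclusion -/

theorem two_mul_one_fourth_pow_le {δ : ℝ} (h0 : 0 < δ) (h1 : δ < 1) :
    2 * (1 / 4 : ℝ) ^ ⌈6 * Real.logb 2 (1 / δ)⌉₊ ≤ δ := by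
  have hlog : 0 < Real.logb 2 (1 / δ) :=
    Real.logb_pos (by norm_num) (by rw [lt_div_iff₀ h0]; linarith)
  set m := ⌈6 * Real.logb 2 (1 / δ)⌉₊ with hm
  have hm1 : 1 ≤ m := Nat.one_le_ceil_iff.2 (by positivity)
  have hle : Real.logb 2 (1 / δ) ≤ m := by
    have := Nat.le_ceil (6 * Real.logb 2 (1 / δ))
    linarith
  rw [Real.logb_le_iff_le_rpow (by norm_num) (by positivity), Real.rpow_natCast] at hle
  have h2 : (1 / 2 : ℝ) ^ m ≤ δ := by
    rw [one_div_pow]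
    exact (one_div_le h0 (by positivity)).1 hle
  have h3 : (1 / 2 : ℝ) ^ m ≤ (1 / 2) ^ 1 :=
    pow_le_pow_of_le_one (by norm_num) (by norm_num) hm1
  -- One factor is at most `δ`; the other is at most `1/2` because `m ≥ 1`, and it absorbs the `2`
  -- of the union bound.
  have h4 : (1 / 4 : ℝ) ^ m = (1 / 2) ^ m * (1 / 2) ^ m := by rw [← mul_pow]; norm_num
  have h5 : (0 : ℝ) < (1 / 2) ^ m := by positivity
  rw [h4]
  nlinarith

theorem ceil_div_sqrt_le {c' p : ℝ} (hc' : 0 < c') (hp : 0 < p) (hp1 : p < 1) :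
    (⌈c' / √p⌉₊ : ℝ) ≤ (c' + 1) / √p := by
  have hp' : 0 < √p := Real.sqrt_pos.2 hp
  have h1 : 1 ≤ 1 / √p := by
    rw [le_div_iff₀ hp', one_mul]; exact Real.sqrt_le_one.2 hp1.le
  rw [add_div]
  have := (Nat.ceil_lt_add_one (show 0 ≤ c' / √p by positivity)).le
  linarith

theorem budget_le {c' p δ : ℝ} (hc' : 0 < c') (hp : 0 < p) (hp1 : p < 1) (h0 : 0 < δ)
    (h1 : δ < 1) :
    (⌈6 * Real.logb 2 (1 / δ)⌉₊ : ℝ) * ⌈c' / √p⌉₊ ≤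
      7 * (c' + 1) * (max 1 (Real.logb 2 (1 / δ)) / √p) := by
  have hlog : 0 < Real.logb 2 (1 / δ) :=
    Real.logb_pos (by norm_num) (by rw [lt_div_iff₀ h0]; linarith)
  have hm : (⌈6 * Real.logb 2 (1 / δ)⌉₊ : ℝ) ≤ 7 * max 1 (Real.logb 2 (1 / δ)) := by
    have := (Nat.ceil_lt_add_one (show 0 ≤ 6 * Real.logb 2 (1 / δ) by positivity)).le
    have := le_max_left 1 (Real.logb 2 (1 / δ))
    have := le_max_right 1 (Real.logb 2 (1 / δ))
    linarith
  refine (mul_le_mul hm (ceil_div_sqrt_le hc' hp hp1) (Nat.cast_nonneg _)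
    (by positivity)).trans_eq ?_
  ring

theorem mainTheorem5 :
    ∃ c' c K : ℝ, 0 < c' ∧ 0 < c ∧ c < 1 ∧ 0 < K ∧
      ∀ {Ω : Type*} [Fintype Ω] {H : Type*} [NormedAddCommGroup H] [InnerProductSpace ℂ H]
        [FiniteDimensional ℂ H] (X : FiniteRV Ω) (b : OrthonormalBasis Ω ℂ H) (D : QDevice H),
        D.toQVariable.Generates b X → IsComparisonOracle b X D.C → IsRotationOracle b X D.R →
        ∀ p δ : ℝ, 0 < p → p < 1 → 0 < δ → δ < 1 →
          1 - δ ≤ D.Pr (quantileAlgorithm c' p δ)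
              (fun Qt _ => X.quantile p ≤ Qt ∧ Qt ≤ X.quantile (c * p)) ∧
          D.Pr (quantileAlgorithm c' p δ)
              (fun _ T => (T : ℝ) ≤ K * (max 1 (Real.logb 2 (1 / δ)) / Real.sqrt p)) = 1 := by
  refine ⟨1664000, 1 / (16 * (1664000 + 1) ^ 2), 7 * (1664000 + 1), by norm_num, by norm_num,
    by norm_num, by norm_num, ?_⟩
  intro Ω _ H _ _ _ X b D hD hC _ p δ hp hp1 hδ hδ1
  have hc' : (0 : ℝ) < 1664000 := by norm_num
  constructor
  · classical
    rw [QDevice.Pr, D.prob_eq_expect]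
    change _ ≤ D.expect _ D.init _
    rw [expect_quantileAlgorithm]
    have hlow := expect_climb_lt_quantile_le hD hC hp hp1 (Nat.le_ceil (1664000 / √p))
    have hhigh := expect_climb_quantile_lt_le hD hC hp hc' (ceil_div_sqrt_le hc' hp hp1)
    set c : ℝ := 1 / (16 * (1664000 + 1) ^ 2)
    have hδm := two_mul_one_fourth_pow_le hδ hδ1
    set m := ⌈6 * Real.logb 2 (1 / δ)⌉₊
    set r := ⌈(1664000 : ℝ) / √p⌉₊
    have h1 := expect_replicate_climb_le hD hC m r r hlow
    have h2 := expect_replicate_climb_le hD hC m r r hhigh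
    have h3 := expect_replicate_climb_one hD hC m r r
    set f : List EReal → ℝ := fun l =>
      (l.map fun a => (1 / 8 : ℝ) + 63 / 8 * if a < X.quantile p then 1 else 0).prod
    set g : List EReal → ℝ := fun l =>
      (l.map fun a => (1 / 8 : ℝ) + 63 / 8 * if X.quantile (c * p) < a then 1 else 0).prod
    -- The union bound in pointwise form: a median that is too low forces `f l ≥ 1`, one that is too
    -- high forces `g l ≥ 1`. The redundant coefficients match `expect_linear`.
    have h4 : ∀ l : List EReal, (1 : ℝ) * 1 + (-1) * (1 * f l + 1 * g l) ≤
        if X.quantile p ≤ listMedian l ∧ listMedian l ≤ X.quantile (c * p) then 1 else 0 := by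
      intro l
      have hpos : ∀ (P : EReal → Prop) [DecidablePred P], 0 ≤
          (l.map fun a => (1 / 8 : ℝ) + 63 / 8 * if P a then 1 else 0).prod := by
        intro P _
        refine List.prod_nonneg fun x hx => ?_
        obtain ⟨a, -, rfl⟩ := List.mem_map.1 hx
        split_ifs <;> norm_num
      have hf : 0 ≤ f l := hpos (fun a => a < X.quantile p)
      have hg : 0 ≤ g l := hpos (fun a => X.quantile (c * p) < a)
      split_ifs with h
      · linarith
      · rw [not_and_or, not_le, not_le] at h
        rcases h with h | h
        · have : 1 ≤ f l := one_le_prod_of_length_le_two_mul_countP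
            (length_le_two_mul_countP_of_listMedian_lower
              (P := fun a => a < X.quantile p) (fun _ _ hac hc => hac.trans_lt hc) h)
          linarith
        · have : 1 ≤ g l := one_le_prod_of_length_le_two_mul_countP
            (length_le_two_mul_countP_of_listMedian_upper
              (P := fun a => X.quantile (c * p) < a) (fun _ _ hac ha => ha.trans_le hac) h)
          linarith
    refine le_trans ?_ (D.expect_mono _ _ h4)
    rw [D.expect_linear _ _ (fun _ => 1) (fun l => 1 * f l + 1 * g l), D.expect_linear, h3]
    linarith
  · rw [QDevice.Pr, D.prob_eq_of_always]
    · change D.expect _ D.init _ = 1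
      rw [expect_quantileAlgorithm]
      exact expect_replicate_climb_one hD hC _ _ _
    · refine (always_quantileAlgorithm 1664000 p δ).mono fun _ t ht => ?_
      refine le_trans ?_ (budget_le hc' hp hp1 hδ hδ1)
      exact_mod_cast ht
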